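/- Let $A$ and $B$ be separable $C^*$-algebras with $B$ stable, i.e. $B\cong \mathbb K\otimes B$, where $\mathbb K$ is the algebra of compact operators on a separable infinite-dimensional Hilbert space. Let $M(B)$ be the multiplier algebra of $B$, $Q(B)=M(B)/B$ the generalized Calkin algebra and $q_B:M(B)\to Q(B)$ the quotient map. For a $C^*$-algebra $D$, an extension of $D$ by $B$ is a $*$-homomorphism $\varphi:D\to Q(B)$. The sum of two extensions $\varphi,\psi$ is $$(\varphi\oplus\psi)(d)=q_B(V_1)\varphi(d)q_B(V_1)^*+q_B(V_2)\psi(d)q_B(V_2)^*,$$ where $V_1,V_2\in M(B)$ are isometries with $V_1V_1^*+V_2V_2^*=1$ (the choice does not matter up to unitary equivalence). The extension $\varphi$ is * split if $\varphi=q_B\circ\pi$ for a $*$-homomorphism $\pi:D\to M(B)$; * asymptotically split if there is an asymptotic homomorphism $\pi_t:D\to M(B)$, $t\in[1,\infty)$, in the sense of Connes and Higson (that is, $t\mapsto\pi_t(d)$ is norm continuous for every $d$, and $\pi_t$ is asymptotically linear, multiplicative and $*$-preserving in norm as $t\to\infty$), with $q_B\circ\pi_t=\varphi$ for all $t$; *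 semi-invertible if $\varphi\oplus\varphi'$ is asymptotically split for some extension $\varphi'$ of $D$ by $B$; * strongly homotopic to $\varphi'$ if there are extensions $\psi_t:D\to Q(B)$, $t\in[0,1]$, with $\psi_0=\varphi$, $\psi_1=\varphi'$ and $t\mapsto\psi_t(d)$ norm continuous for every $d\in D$; * strongly homotopy invertible if $\varphi\oplus\psi$ is strongly homotopic to a split extension for some extension $\psi$ of $D$ by $B$. Then: 1. if all extensions of $A$ by $B$ are semi-invertible, then all extensions of $C(\mathbb T)\otimes A$ by $B$ are semi-invertible; 2. if all extensions of $A$ by $B$ are strongly homotopy invertible, then all extensions of $C(\mathbb T)\otimes A$ by $B$ are strongly homotopy invertible. -/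

import Mathlib

open scoped MultiplierAlgebra

namespace CStarExt

noncomputable section

universe u v w

section Stable

variable (B : Type v) [NonUnitalCStarAlgebra B] (C : Type w) [NonUnitalCStarAlgebra C]

/-- A realization of the C⋆-algebra `C` as the tensor product `𝕂 ⊗ B`, where `𝕂` is the algebra of
compact operators on a separable infinite-dimensional Hilbert space with matrix units `(e_{ij})`,
`i, j ∈ ℕ`: the map `unit i j` is `b ↦ e_{ij} ⊗ b`. These maps multiply and star as
elementary tensors do, they are injective, and their ranges span a dense subspace.
Thus `C` is a C⋆-completion of the ⋆-algebra of finitely supported `ℕ × ℕ`-matrices over `B`, the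
union of the matrix algebras `M_n(B)` under the upper left corner embeddings. As every
`M_n(B)` has exactly one C⋆-norm, so has this union, and its completion is `𝕂 ⊗ B`. -/
structure CompactTensor where
  /-- The map `b ↦ e_{ij} ⊗ b`. -/
  unit : ℕ → ℕ → B →ₗ[ℂ] C
  unit_mul_same : ∀ (i j l : ℕ) (b c : B), unit i j b * unit j l c = unit i l (b * c)
  unit_mul_of_ne : ∀ (i j k l : ℕ) (b c : B), j ≠ k → unit i j b * unit k l c = 0
  star_unit : ∀ (i j : ℕ) (b : B), star (unit i j b) = unit j i (star b)
  unit_injective : ∀ i j : ℕ, Function.Injective (unit i j)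
  dense_span : Dense (Submodule.span ℂ {x : C | ∃ (i j : ℕ) (b : B), unit i j b = x} : Set C)

/-- `B` is stable: `B ≅ 𝕂 ⊗ B`. -/
def IsStable : Prop := Nonempty (CompactTensor B B)

end Stable

section Corona

variable (B : Type v) [NonUnitalCStarAlgebra B]

/-- The image of `B` in its multiplier algebra `M(B)`, as an ideal. -/
def baseIdeal : Ideal 𝓜(ℂ, B) where
  carrier := Set.range (DoubleCentralizer.coeHom (𝕜 := ℂ) (A := B))
  add_mem' := by
    rintro _ _ ⟨a, rfl⟩ ⟨b, rfl⟩
    exact ⟨a + b, map_add _ a b⟩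
  zero_mem' := ⟨0, map_zero _⟩
  smul_mem' := by
    rintro m _ ⟨b, rfl⟩
    refine ⟨m.fst b, ?_⟩
    refine DoubleCentralizer.ext ℂ B _ _ (Prod.ext ?_ ?_)
    · ext x
      change m.fst b * x = m.fst (b * x)
      -- faithfulness of left multiplication on a C⋆-algebra
      rw [← sub_eq_zero, ← CStarRing.star_mul_self_eq_zero_iff, mul_sub, sub_eq_zero,
        ← m.central, ← mul_assoc, ← m.central, mul_assoc]
    · ext x
      change x * m.fst b = m.snd x * b
      exact (m.central x b).symm

instance baseIdeal_isTwoSided : (baseIdeal B).IsTwoSided where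
  mul_mem_of_left := by
    rintro _ m ⟨b, rfl⟩
    refine ⟨m.snd b, ?_⟩
    refine DoubleCentralizer.ext ℂ B _ _ (Prod.ext ?_ ?_)
    · ext x
      change m.snd b * x = b * m.fst x
      exact m.central b x
    · ext x
      change x * m.snd b = m.snd (x * b)
      rw [← sub_eq_zero, ← CStarRing.mul_star_self_eq_zero_iff, sub_mul, sub_eq_zero,
        m.central, mul_assoc, m.central, mul_assoc]

theorem star_mem_baseIdeal {m : 𝓜(ℂ, B)} (hm : m ∈ baseIdeal B) : star m ∈ baseIdeal B := by
  obtain ⟨b, rfl⟩ := hm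
  exact ⟨star b, map_star _ b⟩

/-- The generalized Calkin algebra `Q(B) = M(B) / B`. Its ring and algebra structures are those of
a quotient by a two-sided ideal, and its norm (hence its topology) is the quotient norm. -/
abbrev Corona : Type v := 𝓜(ℂ, B) ⧸ baseIdeal B

/-- The canonical surjection `q_B : M(B) → Q(B)`. -/
def q : 𝓜(ℂ, B) →+* Corona B := Ideal.Quotient.mk (baseIdeal B)

instance : StarRing (Corona B) where
  star := Quotient.map' star fun x y h => by
    rw [Submodule.quotientRel_def] at h ⊢
    rw [← star_sub]
    exact star_mem_baseIdeal B h
  star_involutive := by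
    rintro ⟨x⟩
    exact congrArg (q B) (star_star x)
  star_mul := by
    rintro ⟨x⟩ ⟨y⟩
    exact congrArg (q B) (star_mul x y)
  star_add := by
    rintro ⟨x⟩ ⟨y⟩
    exact congrArg (q B) (star_add x y)

theorem q_star (m : 𝓜(ℂ, B)) : q B (star m) = star (q B m) := rfl

theorem q_smul (c : ℂ) (m : 𝓜(ℂ, B)) : q B (c • m) = c • q B m := rfl

/-- An isometry pair in `M(B)`: `V₁* V₁ = V₂* V₂ = 1` and `V₁ V₁* + V₂ V₂* = 1`. -/
structure IsometryPair where
  V₁ : 𝓜(ℂ, B)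
  V₂ : 𝓜(ℂ, B)
  isometry₁ : star V₁ * V₁ = 1
  isometry₂ : star V₂ * V₂ = 1
  sum_range : V₁ * star V₁ + V₂ * star V₂ = 1

variable {B}

theorem IsometryPair.orthogonal (P : IsometryPair B) : star P.V₁ * P.V₂ = 0 := by
  have h := congrArg (fun x => star P.V₁ * x * P.V₂) P.sum_range
  simp only [mul_add, add_mul, mul_one] at h
  rw [← mul_assoc, P.isometry₁, one_mul, ← mul_assoc, mul_assoc (star P.V₁ * P.V₂),
    P.isometry₂, mul_one] at h
  simpa using h

theorem IsometryPair.orthogonal' (P : IsometryPair B) : star P.V₂ * P.V₁ = 0 := by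
  simpa using congrArg star P.orthogonal

end Corona

section Extensions

variable (A : Type u) [NonUnitalCStarAlgebra A] (B : Type v) [NonUnitalCStarAlgebra B]

/-- Extensions of `A` by `B`, given by their Busby invariants: ⋆-homomorphisms `A → Q(B)`. -/
abbrev Extension : Type (max u v) := A →⋆ₙₐ[ℂ] Corona B

variable {A B}

/-- The sum `φ ⊕ ψ` of two extensions, formed with the isometries `V₁, V₂`:
`a ↦ q(V₁) φ(a) q(V₁)* + q(V₂) ψ(a) q(V₂)*`. -/
def Extension.sum (P : IsometryPair B) (φ ψ : Extension A B) : Extension A B where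
  toFun a := q B P.V₁ * φ a * star (q B P.V₁) + q B P.V₂ * ψ a * star (q B P.V₂)
  map_smul' c a := by
    simp [smul_add]
  map_zero' := by simp
  map_add' a b := by
    simp only [map_add, mul_add, add_mul]
    abel
  map_mul' a b := by
    have h₁ : star (q B P.V₁) * q B P.V₁ = 1 := by
      rw [← q_star, ← map_mul, P.isometry₁, map_one]
    have h₂ : star (q B P.V₂) * q B P.V₂ = 1 := by
      rw [← q_star, ← map_mul, P.isometry₂, map_one]
    have h₃ : star (q B P.V₁) * q B P.V₂ = 0 := by
      rw [← q_star, ← map_mul, P.orthogonal, map_zero]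
    have h₄ : star (q B P.V₂) * q B P.V₁ = 0 := by
      rw [← q_star, ← map_mul, P.orthogonal', map_zero]
    have key : ∀ v w x y s : Corona B,
        v * x * star w * (s * y) = v * x * (star w * s) * y := by
      intro v w x y s
      simp only [mul_assoc]
    simp only [map_mul, mul_add, add_mul]
    rw [mul_assoc (q B P.V₁) (φ b), mul_assoc (q B P.V₂) (ψ b), key, key, key, key,
      h₁, h₂, h₃, h₄]
    simp [mul_assoc]
  map_star' a := by
    simp [mul_assoc, map_star]

/-- `φ` is split: it lifts to a ⋆-homomorphism `A → M(B)`. -/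
def Extension.IsSplit (φ : Extension A B) : Prop :=
  ∃ π : A →⋆ₙₐ[ℂ] 𝓜(ℂ, B), ∀ a, q B (π a) = φ a

/-- `(π t)`, `t ∈ [1, ∞)`, is an asymptotic homomorphism from `A` to `M(B)` in the sense of Connes
and Higson (the values of `π` at `t < 1` play no role). -/
structure IsAsymptoticHom (π : ℝ → A → 𝓜(ℂ, B)) : Prop where
  continuousOn : ∀ a, ContinuousOn (fun t => π t a) (Set.Ici 1)
  add_smul : ∀ (a b : A) (c : ℂ),
    Filter.Tendsto (fun t => π t (a + c • b) - (π t a + c • π t b)) Filter.atTop (nhds 0)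
  mul : ∀ a b : A,
    Filter.Tendsto (fun t => π t (a * b) - π t a * π t b) Filter.atTop (nhds 0)
  star : ∀ a : A,
    Filter.Tendsto (fun t => π t (star a) - star (π t a)) Filter.atTop (nhds 0)

/-- `φ` is asymptotically split: it lifts to an asymptotic homomorphism `A → M(B)`. -/
def Extension.IsAsymptoticallySplit (φ : Extension A B) : Prop :=
  ∃ π : ℝ → A → 𝓜(ℂ, B), IsAsymptoticHom π ∧ ∀ t : ℝ, 1 ≤ t → ∀ a, q B (π t a) = φ a

/-- `φ` and `ψ` are strongly homotopic: they are joined by a path of extensions that is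
continuous for pointwise norm convergence. -/
def Extension.StronglyHomotopic (φ ψ : Extension A B) : Prop :=
  ∃ h : unitInterval → Extension A B,
    (∀ a, Continuous fun t => h t a) ∧ h 0 = φ ∧ h 1 = ψ

/-- `φ` is semi-invertible: `φ ⊕ φ'` is asymptotically split for some extension `φ'`. Sums formed
with different isometries are unitarily equivalent, so that their choice is immaterial. -/
def Extension.IsSemiInvertible (φ : Extension A B) : Prop :=
  ∃ (P : IsometryPair B) (φ' : Extension A B), (φ.sum P φ').IsAsymptoticallySplit

/-- `φ` is strongly homotopy invertible: `φ ⊕ φ'` is strongly homotopic to a split extension for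
some extension `φ'`. -/
def Extension.IsStronglyHomotopyInvertible (φ : Extension A B) : Prop :=
  ∃ (P : IsometryPair B) (φ' σ : Extension A B),
    σ.IsSplit ∧ (φ.sum P φ').StronglyHomotopic σ

end Extensions

end

end CStarExt

/-! Let `c` be complex conjugation on the circle and `φ` an extension of `C(𝕋) ⊗ A`, realised as
`C(𝕋, A)`. Rotating `diag(g, g ∘ c)` over the lower half circle only gives a path of ⋆-homomorphisms
into two-by-two matrices over `C(𝕋, A)`, because the two entries agree at `±1`, where a rotation
therefore does nothing. At the right angle both entries factor through the folding of the circle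
onto its upper half, an arc that contracts to `1`. Hence `φ ⊕ (φ ∘ c)` is strongly homotopic to the
pullback, along evaluation at `1`, of `φ₀ ⊕ φ₀`, where `φ₀` is `φ` on constants. This is an
extension of `A`, so it has a partner `χ` by hypothesis, and `(φ ∘ c) ⊕ (χ ∘ ev₁)` is a partner for
`φ` up to strong homotopy (`Extension.stronglyHomotopic_evalOne`). The second claim follows by
transitivity.

The first claim also needs asymptotic splitting to be invariant under strong homotopy
(`Extension.StronglyHomotopic.isAsymptoticallySplit`). Given a homotopy `h_s` and an asymptotic lift
`l_t` of `h_0`, the Bartle–Graves theorem supplies bounded lifts `z_a(s, t)` of `h_s(a)`, continuous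
in `a` and asymptotic to `l_t(a)` at `s = 0`. Let `w_t` run through complements of a quasicentral
approximate unit of `B`, put `R = (t + 4) w_t`, let `k_i` be the square root of the tent at the
integer `i` applied to `R`, and set `Φ_t(z) = ∑ k_i z(s_i, t) k_i`, with nodes `s_i` growing from
`0` to `1` in steps of order `1/t`.

Modulo `B` the element `R` is the scalar `t + 4`, which only meets tents with `s_i = 1`, so
`Φ_t(z_a)` lifts `h_1(a)`. The failure of `z` to be a ⋆-homomorphism takes values in `B`. For `i ≥
2` these values are nearly annihilated by `k_i`, which is dominated by `R`. For `i < 2` the node is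
`s_i = 0`, where they tend to zero because `l` is an asymptotic homomorphism. Finally `Φ_t` is
asymptotically multiplicative, since the `k_i` almost commute with the values of `z` and
neighbouring values differ little modulo `B` (`exists_asymptotic_compression`). -/

namespace CStarExt

noncomputable section

open Filter Topology
open scoped BoundedContinuousFunction

/-! ### Norm estimates for rows, columns and functional calculus. -/

section CStarEstimates

variable {N : Type*} [CStarAlgebra N] [PartialOrder N] [StarOrderedRing N]

theorem norm_le_one_of_le_one {a : N} (h0 : 0 ≤ a) (h1 : a ≤ 1) : ‖a‖ ≤ 1 :=
  (CStarAlgebra.norm_le_one_iff_of_nonneg a).2 h1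

open scoped InnerProductSpace in
/-- Cauchy–Schwarz for finite rows and columns. -/
theorem norm_sum_mul_le_sqrt {ι : Type*} (s : Finset ι) (a b : ι → N) :
    ‖∑ i ∈ s, a i * b i‖ ≤
      √‖∑ i ∈ s, a i * star (a i)‖ * √‖∑ i ∈ s, star (b i) * b i‖ := by
  classical
  -- This is Cauchy–Schwarz in the Hilbert module of finite families, whose inner product is `⟨x, y⟩
  -- = ∑ yᵢ xᵢ*`; hence the adjoint on `b`.
  let x : WithCStarModule N (∀ _ : s, N) := WithCStarModule.equiv N _ |>.symm fun i => star (b i)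
  let y : WithCStarModule N (∀ _ : s, N) := WithCStarModule.equiv N _ |>.symm fun i => a i
  have h := CStarModule.norm_inner_le (A := N) (WithCStarModule N (∀ _ : s, N)) (x := x) (y := y)
  rw [WithCStarModule.pi_inner, WithCStarModule.pi_norm, WithCStarModule.pi_norm] at h
  have e1 : ∑ i : s, inner N (x i) (y i) = ∑ i ∈ s, a i * b i := by
    rw [← Finset.sum_coe_sort s]
    refine Finset.sum_congr rfl fun i _ => ?_
    simp [x, y, WithCStarModule.inner_def]
  have e2 : ∑ i : s, inner N (x i) (x i) = ∑ i ∈ s, star (b i) * b i := by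
    rw [← Finset.sum_coe_sort s]
    refine Finset.sum_congr rfl fun i _ => ?_
    simp [x, WithCStarModule.inner_def]
  have e3 : ∑ i : s, inner N (y i) (y i) = ∑ i ∈ s, a i * star (a i) := by
    rw [← Finset.sum_coe_sort s]
    refine Finset.sum_congr rfl fun i _ => ?_
    simp [y, WithCStarModule.inner_def]
  rw [e1, e2, e3] at h
  rw [mul_comm]
  exact h

/-- `‖∑ cᵢ* xᵢ dᵢ‖ ≤ max ‖xᵢ‖` for columns `c`, `d` of norm at most one. -/
theorem norm_sum_star_mul_mul_le {ι : Type*} (s : Finset ι) (c x d : ι → N) {M : ℝ} (hM : 0 ≤ M)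
    (hc : ∑ i ∈ s, star (c i) * c i ≤ 1) (hd : ∑ i ∈ s, star (d i) * d i ≤ 1)
    (hx : ∀ i ∈ s, ‖x i‖ ≤ M) : ‖∑ i ∈ s, star (c i) * x i * d i‖ ≤ M := by
  refine (norm_sum_mul_le_sqrt s (fun i => star (c i) * x i) d).trans ?_
  have h1 : ‖∑ i ∈ s, star (d i) * d i‖ ≤ 1 :=
    norm_le_one_of_le_one (Finset.sum_nonneg fun i _ => star_mul_self_nonneg _) hd
  have h2 : ‖∑ i ∈ s, star (c i) * x i * star (star (c i) * x i)‖ ≤ M ^ 2 := by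
    have h3 : ∑ i ∈ s, star (c i) * x i * star (star (c i) * x i) ≤ (M ^ 2 : ℝ) • (1 : N) := by
      calc _ ≤ ∑ i ∈ s, (M ^ 2 : ℝ) • (star (c i) * c i) := by
            refine Finset.sum_le_sum fun i hi => ?_
            have h4 : x i * star (x i) ≤ (M ^ 2 : ℝ) • (1 : N) := by
              have := IsSelfAdjoint.le_algebraMap_norm_self (IsSelfAdjoint.mul_star_self (x i))
              refine this.trans ?_
              rw [Algebra.algebraMap_eq_smul_one, CStarRing.norm_self_mul_star, ← sq]
              exact smul_le_smul_of_nonneg_right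
                (pow_le_pow_left₀ (norm_nonneg _) (hx i hi) 2) zero_le_one
            have h5 := star_left_conjugate_le_conjugate h4 (c i)
            simpa [mul_assoc] using h5
        _ = (M ^ 2 : ℝ) • ∑ i ∈ s, star (c i) * c i := by rw [Finset.smul_sum]
        _ ≤ _ := smul_le_smul_of_nonneg_left hc (by positivity)
    refine (CStarAlgebra.norm_le_norm_of_nonneg_of_le
      (Finset.sum_nonneg fun i _ => mul_star_self_nonneg _) h3).trans ?_
    rw [norm_smul]
    have : ‖(1 : N)‖ ≤ 1 := norm_le_one_of_le_one zero_le_one le_rfl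
    rw [Real.norm_of_nonneg (by positivity)]
    nlinarith [sq_nonneg M]
  calc _ ≤ √(M ^ 2) * √1 := by gcongr
    _ = M := by simp [Real.sqrt_sq hM]

theorem norm_commutator_pow_le (R x : N) {ρ : ℝ} (hρ : ‖R‖ ≤ ρ) (k : ℕ) :
    ‖R ^ k * x - x * R ^ k‖ ≤ k * ρ ^ (k - 1) * ‖R * x - x * R‖ := by
  have hρ0 : 0 ≤ ρ := (norm_nonneg _).trans hρ
  have h1 : ‖(1 : N)‖ ≤ 1 := norm_le_one_of_le_one zero_le_one le_rfl
  have hp : ∀ k, ‖R ^ k‖ ≤ ρ ^ k := fun k => by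
    induction k with
    | zero => simpa using h1
    | succ k ih =>
      rw [pow_succ, pow_succ]
      exact (norm_mul_le _ _).trans (by gcongr)
  induction k with
  | zero => simp
  | succ k ih =>
    have e : R ^ (k + 1) * x - x * R ^ (k + 1) =
        R ^ k * (R * x - x * R) + (R ^ k * x - x * R ^ k) * R := by
      rw [pow_succ]; noncomm_ring
    rw [e]
    calc _ ≤ ‖R ^ k‖ * ‖R * x - x * R‖ + ‖R ^ k * x - x * R ^ k‖ * ‖R‖ :=
          (norm_add_le _ _).trans (add_le_add (norm_mul_le _ _) (norm_mul_le _ _))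
      _ ≤ ρ ^ k * ‖R * x - x * R‖ + (k * ρ ^ (k - 1) * ‖R * x - x * R‖) * ρ := by
          gcongr
          exact hp k
      _ = ((k + 1 : ℕ) : ℝ) * ρ ^ (k + 1 - 1) * ‖R * x - x * R‖ := by
          rcases k with _ | k
          · simp
          · rw [show k + 1 + 1 - 1 = k + 1 by omega, show k + 1 - 1 = k by omega]
            push_cast
            ring

theorem spectrum_subset_Icc_of_le {R : N} {ρ : ℝ} (h0 : 0 ≤ R) (h1 : R ≤ ρ • (1 : N)) :
    spectrum ℝ R ⊆ Set.Icc 0 ρ := by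
  intro x hx
  refine ⟨spectrum_nonneg_of_nonneg h0 hx, ?_⟩
  rw [← Algebra.algebraMap_eq_smul_one] at h1
  exact (le_algebraMap_iff_spectrum_le (ha := h0.isSelfAdjoint)).1 h1 x hx

/-- On `[0, ρ]` the function `f` is uniformly close to a polynomial, whose commutators obey the
Leibniz rule. The polynomial depends only on `f`, `ρ`, `ε` and `M`, so `δ` is uniform in `R` and
`x`. -/
theorem exists_norm_commutator_cfc_le (f : ℝ → ℝ) (hf : Continuous f) (ρ : ℝ) (hρ : 0 ≤ ρ) {ε M : ℝ}
    (hε : 0 < ε) (hM : 0 ≤ M) :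
    ∃ δ > 0, ∀ R x : N, 0 ≤ R → R ≤ ρ • (1 : N) → ‖x‖ ≤ M → ‖R * x - x * R‖ ≤ δ →
      ‖cfc f R * x - x * cfc f R‖ ≤ ε := by
  have hη : 0 < ε / (2 * (2 * M + 1)) := by positivity
  obtain ⟨p, hp⟩ := exists_polynomial_near_of_continuousOn 0 ρ f hf.continuousOn _ hη
  set C : ℝ := ∑ k ∈ p.support, |p.coeff k| * (k * ρ ^ (k - 1)) with hC
  have hC0 : 0 ≤ C := Finset.sum_nonneg fun k _ => by positivity
  refine ⟨ε / (2 * (C + 1)), by positivity, fun R x h0 h1 hx hc => ?_⟩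
  have hspec := spectrum_subset_Icc_of_le h0 h1
  have h1' : ‖(1 : N)‖ ≤ 1 := norm_le_one_of_le_one zero_le_one le_rfl
  have hR : ‖R‖ ≤ ρ := by
    refine (CStarAlgebra.norm_le_norm_of_nonneg_of_le h0 h1).trans ?_
    rw [norm_smul, Real.norm_of_nonneg hρ]
    nlinarith
  set P := Polynomial.aeval R p with hP
  have hd : ‖cfc f R - P‖ ≤ ε / (2 * (2 * M + 1)) := by
    have : P = cfc p.eval R := (cfc_polynomial p R h0.isSelfAdjoint).symm
    rw [this, ← cfc_sub f p.eval R hf.continuousOn (by fun_prop)]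
    refine norm_cfc_le hη.le fun y hy => ?_
    rw [Real.norm_eq_abs, abs_sub_comm]
    exact (hp y (hspec hy)).le
  have hPc : ‖P * x - x * P‖ ≤ C * ‖R * x - x * R‖ := by
    have : P * x - x * P = ∑ k ∈ p.support, p.coeff k • (R ^ k * x - x * R ^ k) := by
      rw [hP, Polynomial.aeval_def, Polynomial.eval₂_def, Polynomial.sum, Finset.sum_mul,
        Finset.mul_sum, ← Finset.sum_sub_distrib]
      refine Finset.sum_congr rfl fun k _ => ?_
      rw [← Algebra.smul_def, smul_mul_assoc, mul_smul_comm, smul_sub]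
    rw [this, hC, Finset.sum_mul]
    refine norm_sum_le_of_le _ fun k _ => ?_
    rw [norm_smul, mul_assoc, Real.norm_eq_abs]
    gcongr
    exact norm_commutator_pow_le R x hR k
  have e : cfc f R * x - x * cfc f R =
      (cfc f R - P) * x - x * (cfc f R - P) + (P * x - x * P) := by noncomm_ring
  rw [e]
  calc _ ≤ ‖cfc f R - P‖ * ‖x‖ + ‖x‖ * ‖cfc f R - P‖ + C * ‖R * x - x * R‖ := by
        refine (norm_add_le _ _).trans (add_le_add ((norm_sub_le _ _).trans ?_) hPc)
        exact add_le_add (norm_mul_le _ _) (norm_mul_le _ _)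
    _ ≤ ε / (2 * (2 * M + 1)) * M + M * (ε / (2 * (2 * M + 1))) + C * (ε / (2 * (C + 1))) := by
        gcongr
    _ ≤ ε / 2 + ε / 2 := by
        refine add_le_add ?_ ?_
        · rw [show ε / (2 * (2 * M + 1)) * M + M * (ε / (2 * (2 * M + 1))) =
            ε / 2 * (2 * M / (2 * M + 1)) by field_simp; ring]
          exact mul_le_of_le_one_right (by positivity)
            ((div_le_one (by positivity)).2 (by linarith))
        · rw [show C * (ε / (2 * (C + 1))) = ε / 2 * (C / (C + 1)) by field_simp]
          exact mul_le_of_le_one_right (by positivity)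
            ((div_le_one (by positivity)).2 (by linarith))
    _ = ε := by ring

/-- If `|f| ≤ |·|` on the spectrum of `R`, then `‖f(R) y‖ ≤ ‖R y‖`. -/
theorem norm_cfc_mul_le {f : ℝ → ℝ} (hf : Continuous f) {R : N} (h0 : 0 ≤ R)
    (hfR : ∀ x ∈ spectrum ℝ R, |f x| ≤ |x|) (y : N) : ‖cfc f R * y‖ ≤ ‖R * y‖ := by
  have hsa : IsSelfAdjoint (cfc f R) := cfc_predicate f R
  have h1 : cfc f R * cfc f R ≤ R * R := by
    have e : R * R = cfc (fun x : ℝ => x * x) R := by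
      rw [cfc_mul (fun x : ℝ => x) (fun x : ℝ => x) R, cfc_id' ℝ R]
    rw [e, ← cfc_mul f f R hf.continuousOn hf.continuousOn]
    refine cfc_mono (fun x hx => ?_) (by fun_prop) (by fun_prop)
    rw [← abs_mul_abs_self (f x), ← abs_mul_abs_self x]
    exact mul_self_le_mul_self (abs_nonneg _) (hfR x hx)
  have h2 := star_left_conjugate_le_conjugate h1 y
  have h3 := CStarAlgebra.norm_le_norm_of_nonneg_of_le (a := star y * (cfc f R * cfc f R) * y) (by
    have : star y * (cfc f R * cfc f R) * y = star (cfc f R * y) * (cfc f R * y) := by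
      rw [star_mul, hsa.star_eq]; simp only [mul_assoc]
    rw [this]; exact star_mul_self_nonneg _) h2
  have e1 : star y * (cfc f R * cfc f R) * y = star (cfc f R * y) * (cfc f R * y) := by
    rw [star_mul, hsa.star_eq]; simp only [mul_assoc]
  have e2 : star y * (R * R) * y = star (R * y) * (R * y) := by
    rw [star_mul, h0.isSelfAdjoint.star_eq]; simp only [mul_assoc]
  rw [e1, e2, CStarRing.norm_star_mul_self, CStarRing.norm_star_mul_self] at h3
  exact le_of_sq_le_sq (by simpa [sq] using h3) (norm_nonneg _)

end CStarEstimates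

/-! ### Quasicentral approximate units. -/

section Quasicentral

variable {N : Type*} [CStarAlgebra N] [PartialOrder N] [StarOrderedRing N]

/-- `J` has an upwards directed approximate unit of positive contractions. -/
def HasIncreasingApproxUnit (J : Ideal N) : Prop :=
  ∃ U : Set N, U ⊆ J ∧ (∀ u ∈ U, 0 ≤ u ∧ u ≤ 1) ∧
    ∀ s Y : Finset N, (∀ u ∈ s, u ∈ U) → (∀ y ∈ Y, y ∈ J) → ∀ ε : ℝ, 0 < ε →
      ∃ u ∈ U, (∀ v ∈ s, v ≤ u) ∧ ∀ y ∈ Y, ‖(1 - u) * y‖ ≤ ε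

theorem mul_self_le_of_le_one {d : N} (h0 : 0 ≤ d) (h1 : d ≤ 1) : d * d ≤ d := by
  have hs := spectrum_subset_Icc_of_le h0 (ρ := 1) (by simpa using h1)
  have e : d * d = cfc (fun x : ℝ => x * x) d := by
    rw [cfc_mul (fun x : ℝ => x) (fun x : ℝ => x) d, cfc_id' ℝ d]
  rw [e]
  conv_rhs => rw [← cfc_id' ℝ d]
  refine cfc_mono fun x hx => ?_
  nlinarith [(hs hx).1, (hs hx).2]

/-- The increments `d j` form a column of norm at most one, since `∑ d j ^ 2 ≤ ∑ d j ≤ 1`. So `∑ d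
(j + 1) * x * d j` is bounded by `‖x‖` however many terms there are, and it differs from the given
sum only by products `(1 - u j) * (x * u i)` with `i < j`. An average over `m` terms is therefore
small. -/
theorem norm_sum_one_sub_mul_mul_le {u : ℕ → N} (hu0 : ∀ n, 0 ≤ u n) (hu1 : ∀ n, u n ≤ 1)
    (hmono : ∀ n, u n ≤ u (n + 1)) {x : N} {η : ℝ}
    (hx : ∀ i j, i < j → ‖(1 - u j) * (x * u i)‖ ≤ η) (m : ℕ) :
    ‖∑ j ∈ Finset.range m, (1 - u (j + 1)) * x * u (j + 1)‖ ≤ ‖x‖ + m * (3 * η) := by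
  set d : ℕ → N := fun j => u (j + 1) - u j with hd
  have hd0 : ∀ j, 0 ≤ d j := fun j => sub_nonneg.2 (hmono j)
  have hd1 : ∀ j, d j ≤ 1 := fun j => (sub_le_self _ (hu0 j)).trans (hu1 _)
  have hsum : ∀ a, ∑ j ∈ Finset.range m, star (d (j + a)) * d (j + a) ≤ 1 := fun a =>
    calc _ ≤ ∑ j ∈ Finset.range m, d (j + a) := Finset.sum_le_sum fun j _ => by
          rw [(hd0 _).isSelfAdjoint.star_eq]
          exact mul_self_le_of_le_one (hd0 _) (hd1 _)
      _ = u (m + a) - u (0 + a) := by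
          rw [← Finset.sum_range_sub (fun j => u (j + a))]
          refine Finset.sum_congr rfl fun j _ => ?_
          simp only [hd]
          rw [show j + a + 1 = j + 1 + a by omega]
      _ ≤ 1 := (sub_le_self _ (hu0 _)).trans (hu1 _)
  have key := norm_sum_star_mul_mul_le (Finset.range m) (fun j => d (j + 1)) (fun _ => x)
    (fun j => d (j + 0)) (norm_nonneg x) (hsum 1) (hsum 0) fun _ _ => le_rfl
  have e : ∑ j ∈ Finset.range m, (1 - u (j + 1)) * x * u (j + 1) =
      (∑ j ∈ Finset.range m, star (d (j + 1)) * x * d (j + 0)) +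
      ∑ j ∈ Finset.range m, ((1 - u (j + 1 + 1)) * (x * u (j + 1)) + (1 - u (j + 1)) * (x * u j)
        - (1 - u (j + 1 + 1)) * (x * u j)) := by
    rw [← Finset.sum_add_distrib]
    refine Finset.sum_congr rfl fun j _ => ?_
    rw [(hd0 _).isSelfAdjoint.star_eq]
    simp only [hd]
    rw [add_zero]
    noncomm_ring
  rw [e]
  refine (norm_add_le _ _).trans (add_le_add key ?_)
  refine (norm_sum_le_of_le (Finset.range m) (n := fun _ => 3 * η) fun j _ => ?_).trans
    (by simp)
  have h1 := hx (j + 1) (j + 1 + 1) (by omega)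
  have h2 := hx j (j + 1) (by omega)
  have h3 := hx j (j + 1 + 1) (by omega)
  have := norm_sub_le ((1 - u (j + 1 + 1)) * (x * u (j + 1)) + (1 - u (j + 1)) * (x * u j))
    ((1 - u (j + 1 + 1)) * (x * u j))
  have := norm_add_le ((1 - u (j + 1 + 1)) * (x * u (j + 1))) ((1 - u (j + 1)) * (x * u j))
  linarith

/-- An average of a rapidly increasing sequence from the approximate unit works: the commutator with
`x` is the difference of two sums of the preceding kind, one of them starred, divided by their
length. -/
theorem exists_quasicentral_finset {J : Ideal N} [J.IsTwoSided] (hJ : HasIncreasingApproxUnit J)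
    (X Y : Finset N) (hY : ∀ y ∈ Y, y ∈ J) {ε : ℝ} (hε : 0 < ε) :
    ∃ u ∈ J, 0 ≤ u ∧ u ≤ 1 ∧ (∀ x ∈ X, ‖u * x - x * u‖ ≤ ε) ∧ ∀ y ∈ Y, ‖(1 - u) * y‖ ≤ ε := by
  classical
  obtain ⟨U, hUJ, hU, happ⟩ := hJ
  set X' := X ∪ X.image star with hX'
  -- The two sums contribute `2 * (K + 3 * m * η) / m`: the choice of `η` makes the second part `ε /
  -- 2`, and `m > 4 * K / ε` bounds the first by `ε / 2`.
  set η := ε / 12 with hη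
  have hη0 : 0 < η := by positivity
  obtain ⟨u, huP, hur⟩ := exists_seq_of_forall_finset_exists
    (fun u : N => u ∈ U ∧ ∀ y ∈ Y, ‖(1 - u) * y‖ ≤ ε)
    (fun v u => v ≤ u ∧ ∀ x ∈ X', ‖(1 - u) * (x * v)‖ ≤ η) (fun s hs => by
      obtain ⟨u, hu, hle, hy⟩ := happ s (Y ∪ Finset.image₂ (· * ·) X' s) (fun v hv => (hs v hv).1)
        (fun y hy => by
          rcases Finset.mem_union.1 hy with h | h
          · exact hY y h
          · obtain ⟨a, -, b, hb, rfl⟩ := Finset.mem_image₂.1 h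
            exact J.mul_mem_left a (hUJ (hs b hb).1)) (min ε η) (lt_min hε hη0)
      refine ⟨u, ⟨hu, fun y h => (hy y (Finset.mem_union_left _ h)).trans (min_le_left _ _)⟩,
        fun v hv => ⟨hle v hv, fun x hx => ?_⟩⟩
      exact (hy _ (Finset.mem_union_right _ (Finset.mem_image₂_of_mem hx hv))).trans
        (min_le_right _ _))
  have hu0 : ∀ n, 0 ≤ u n := fun n => (hU _ (huP n).1).1
  have hu1 : ∀ n, u n ≤ 1 := fun n => (hU _ (huP n).1).2
  have hmono : ∀ n, u n ≤ u (n + 1) := fun n => (hur n (n + 1) (by omega)).1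
  obtain ⟨K, hK⟩ : ∃ K : ℝ, ∀ x ∈ X', ‖x‖ ≤ K := by
    obtain ⟨K, hK⟩ := (X'.finite_toSet.image norm).bddAbove
    exact ⟨K, fun x hx => hK ⟨x, hx, rfl⟩⟩
  obtain ⟨m, hm⟩ := exists_nat_gt (max 0 (4 * K / ε))
  have hm0 : (0 : ℝ) < m := (le_max_left _ _).trans_lt hm
  have hmK : 4 * K ≤ ε * m := by
    have := (le_max_right _ _).trans_lt hm
    rw [div_lt_iff₀ hε] at this
    linarith
  have hmi : (0 : ℝ) ≤ (m : ℝ)⁻¹ := by positivity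
  have hsum : ∀ x ∈ X', ‖∑ j ∈ Finset.range m, (1 - u (j + 1)) * x * u (j + 1)‖ ≤
      K + m * (3 * η) := fun x hx =>
    (norm_sum_one_sub_mul_mul_le hu0 hu1 hmono (fun i j hij => (hur i j hij).2 x hx) m).trans
      (add_le_add (hK x hx) le_rfl)
  refine ⟨(m : ℝ)⁻¹ • ∑ j ∈ Finset.range m, u (j + 1), ?_, ?_, ?_, fun x hx => ?_, fun y hy => ?_⟩
  · rw [← smul_one_mul]
    exact J.mul_mem_left _ (J.sum_mem fun j _ => hUJ (huP _).1)
  · exact smul_nonneg hmi (Finset.sum_nonneg fun j _ => hu0 _)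
  · calc _ ≤ (m : ℝ)⁻¹ • ∑ j ∈ Finset.range m, (1 : N) :=
          smul_le_smul_of_nonneg_left (Finset.sum_le_sum fun j _ => hu1 _) hmi
      _ = 1 := by
          rw [Finset.sum_const, Finset.card_range, ← Nat.cast_smul_eq_nsmul ℝ, smul_smul,
            inv_mul_cancel₀ hm0.ne', one_smul]
  · have h1 := hsum x (Finset.mem_union_left _ hx)
    have h2 := hsum (star x) (Finset.mem_union_right _ (Finset.mem_image_of_mem _ hx))
    have e : (m : ℝ)⁻¹ • (∑ j ∈ Finset.range m, u (j + 1)) * x -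
        x * (m : ℝ)⁻¹ • (∑ j ∈ Finset.range m, u (j + 1)) =
        (m : ℝ)⁻¹ • (star (∑ j ∈ Finset.range m, (1 - u (j + 1)) * star x * u (j + 1)) -
          ∑ j ∈ Finset.range m, (1 - u (j + 1)) * x * u (j + 1)) := by
      rw [smul_mul_assoc, mul_smul_comm, ← smul_sub, Finset.sum_mul, Finset.mul_sum, star_sum,
        ← Finset.sum_sub_distrib, ← Finset.sum_sub_distrib]
      congr 1
      refine Finset.sum_congr rfl fun j _ => ?_
      simp only [star_mul, star_sub, star_one, star_star, (hu0 _).isSelfAdjoint.star_eq]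
      noncomm_ring
    rw [e, norm_smul, Real.norm_of_nonneg hmi, inv_mul_le_iff₀ hm0]
    refine (norm_sub_le _ _).trans ?_
    rw [norm_star]
    have : η * 12 = ε := by rw [hη]; ring
    nlinarith
  · have e : (1 - (m : ℝ)⁻¹ • ∑ j ∈ Finset.range m, u (j + 1)) * y =
        (m : ℝ)⁻¹ • ∑ j ∈ Finset.range m, (1 - u (j + 1)) * y := by
      simp only [sub_mul, one_mul, Finset.sum_sub_distrib, Finset.sum_const, Finset.card_range,
        smul_sub, smul_mul_assoc, Finset.sum_mul]
      rw [← Nat.cast_smul_eq_nsmul ℝ, smul_smul, inv_mul_cancel₀ hm0.ne', one_smul]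
    rw [e, norm_smul, Real.norm_of_nonneg hmi, inv_mul_le_iff₀ hm0]
    refine (norm_sum_le_of_le _ fun j _ => (huP (j + 1)).2 y hy).trans ?_
    simp

/-- Quasicentral approximate units: `w` is the complement of a member of such a unit. -/
theorem exists_quasicentral {J : Ideal N} [J.IsTwoSided] (hJ : HasIncreasingApproxUnit J)
    {K Y : Set N} (hK : IsCompact K) (hY : Y.Finite) (hYJ : Y ⊆ J) {ε : ℝ} (hε : 0 < ε) :
    ∃ w : N, 0 ≤ w ∧ w ≤ 1 ∧ 1 - w ∈ J ∧ (∀ x ∈ K, ‖w * x - x * w‖ ≤ ε) ∧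
      ∀ y ∈ Y, ‖w * y‖ ≤ ε ∧ ‖y * w‖ ≤ ε := by
  classical
  obtain ⟨t, -, ht, hKt⟩ := hK.finite_cover_balls (e := ε / 4) (by positivity)
  -- Including `Y` among the elements almost commuting with `u` turns smallness of `w * y` into
  -- smallness of `y * w`.
  obtain ⟨u, huJ, hu0, hu1, hX, hYu⟩ := exists_quasicentral_finset hJ (ht.toFinset ∪ hY.toFinset)
    hY.toFinset (fun y hy => hYJ (by simpa using hy)) (ε := ε / 2) (by positivity)
  have hun : ‖u‖ ≤ 1 := norm_le_one_of_le_one hu0 hu1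
  have hcomm : ∀ x, (1 - u) * x - x * (1 - u) = -(u * x - x * u) := fun x => by noncomm_ring
  refine ⟨1 - u, sub_nonneg.2 hu1, sub_le_self _ hu0, by simpa using huJ, fun x hx => ?_,
    fun y hy => ⟨(hYu y (by simpa using hy)).trans (by linarith), ?_⟩⟩
  · rw [hcomm, norm_neg]
    obtain ⟨x', hx', hxx⟩ := Set.mem_iUnion₂.1 (hKt hx)
    have h1 := hX x' (by simp [hx'])
    rw [Metric.mem_ball, dist_eq_norm] at hxx
    have e : u * x - x * u = (u * x' - x' * u) + (u * (x - x') - (x - x') * u) := by noncomm_ring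
    rw [e]
    calc _ ≤ ε / 2 + (‖u‖ * ‖x - x'‖ + ‖x - x'‖ * ‖u‖) :=
          (norm_add_le _ _).trans (add_le_add h1 ((norm_sub_le _ _).trans
            (add_le_add (norm_mul_le _ _) (norm_mul_le _ _))))
      _ ≤ ε / 2 + (1 * (ε / 4) + (ε / 4) * 1) := by gcongr
      _ = ε := by ring
  · have h1 := hYu y (by simpa using hy)
    have h2 := hX y (by simp [hy])
    have e : y * (1 - u) = (1 - u) * y + (u * y - y * u) := by noncomm_ring
    rw [e]
    exact (norm_add_le _ _).trans (by linarith)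

end Quasicentral

/-! ### The ideal `B` of `M(B)`: closedness and approximate unit. -/

section MultiplierIdeal

variable (B : Type*) [NonUnitalCStarAlgebra B]

theorem norm_coeHom (b : B) : ‖DoubleCentralizer.coeHom (𝕜 := ℂ) (A := B) b‖ = ‖b‖ :=
  (DoubleCentralizer.norm_fst _).symm.trans (ContinuousLinearMap.opNorm_mul_apply ℂ B b)

theorem isClosed_baseIdeal : IsClosed (baseIdeal B : Set 𝓜(ℂ, B)) := by
  have h : Isometry (DoubleCentralizer.coeHom (𝕜 := ℂ) (A := B)) :=
    AddMonoidHomClass.isometry_of_norm _ (norm_coeHom B)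
  exact h.isClosedEmbedding.isClosed_range

theorem hasIncreasingApproxUnit_baseIdeal [PartialOrder 𝓜(ℂ, B)] [StarOrderedRing 𝓜(ℂ, B)] :
    HasIncreasingApproxUnit (baseIdeal B) := by
  classical
  let _ : PartialOrder B := CStarAlgebra.spectralOrder B
  have _ : StarOrderedRing B := CStarAlgebra.spectralOrderedRing B
  set c := DoubleCentralizer.coeHom (𝕜 := ℂ) (A := B) with hc
  refine ⟨c '' {b | 0 ≤ b ∧ ‖b‖ < 1}, ?_, ?_, fun s Y hs hY ε hε => ?_⟩
  · rintro _ ⟨b, -, rfl⟩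
    exact ⟨b, rfl⟩
  · rintro _ ⟨b, ⟨h0, h1⟩, rfl⟩
    have h0' : 0 ≤ c b := map_nonneg c h0
    exact ⟨h0', (CStarAlgebra.norm_le_one_iff_of_nonneg _).1
      ((norm_coeHom B b).trans_le h1.le)⟩
  · have happ := CStarAlgebra.increasingApproximateUnit B
    have h1 : ∀ᶠ e in CStarAlgebra.approximateUnit B, ∀ v ∈ s, v ≤ c e := by
      rw [Finset.eventually_all]
      intro v hv
      obtain ⟨b, ⟨hb0, hb1⟩, rfl⟩ := hs v hv
      have : {x | b ≤ x} ∩ Metric.closedBall 0 1 ∈ CStarAlgebra.approximateUnit B :=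
        (CStarAlgebra.hasBasis_approximateUnit B).mem_of_mem (i := b) ⟨hb0, hb1⟩
      filter_upwards [this] with e he
      have := map_nonneg c (sub_nonneg.2 he.1)
      rw [map_sub] at this
      exact sub_nonneg.1 this
    have h2 : ∀ᶠ e in CStarAlgebra.approximateUnit B, ∀ y ∈ Y, ‖(1 - c e) * y‖ ≤ ε := by
      rw [Finset.eventually_all]
      intro y hy
      obtain ⟨b, rfl⟩ := hY y hy
      have := (happ.tendsto_mul_right b).sub_const b
      rw [sub_self] at this
      filter_upwards [this.norm.eventually (ge_mem_nhds (by simpa using hε))] with e he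
      have e1 : (1 - c e) * c b = -c (e * b - b) := by
        rw [map_sub, map_mul, sub_mul, one_mul, neg_sub]
      change ‖(1 - c e) * c b‖ ≤ ε
      rw [e1, norm_neg, norm_coeHom]
      exact he
    obtain ⟨a, ha, h⟩ := (CStarAlgebra.hasBasis_approximateUnit B).eventually_iff.1 (h1.and h2)
    -- The element `a` lies in its own basic set, so it is itself a common upper bound from the open
    -- unit ball.
    have haa := h (x := a) ⟨le_refl a, by simpa using ha.2.le⟩
    exact ⟨c a, ⟨a, ha, rfl⟩, haa.1, haa.2⟩

end MultiplierIdeal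

/-! ### A square-root partition of unity on the half line. -/

section Tents

/-- The square root of the tent function of height one over `[i - 1, i + 1]`. -/
def tentRoot (i : ℕ) (x : ℝ) : ℝ := √(max 0 (1 - |x - i|))

theorem continuous_tentRoot (i : ℕ) : Continuous (tentRoot i) := by
  unfold tentRoot
  fun_prop

theorem tentRoot_nonneg (i : ℕ) (x : ℝ) : 0 ≤ tentRoot i x := Real.sqrt_nonneg _

theorem tentRoot_le_one (i : ℕ) (x : ℝ) : tentRoot i x ≤ 1 := by
  rw [tentRoot, Real.sqrt_le_iff, one_pow]
  exact ⟨zero_le_one, max_le zero_le_one (by linarith [abs_nonneg (x - i)])⟩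

theorem tentRoot_mul_self (i : ℕ) (x : ℝ) :
    tentRoot i x * tentRoot i x = max 0 (1 - |x - i|) :=
  Real.mul_self_sqrt (le_max_left _ _)

theorem tentRoot_eq_zero {i : ℕ} {x : ℝ} (h : 1 ≤ |x - i|) : tentRoot i x = 0 := by
  rw [tentRoot, max_eq_left (by linarith), Real.sqrt_zero]

/-- The tents centred at `2` or beyond vanish on `[0, 1]`. Domination by the identity is what lets
`‖R * y‖` control `‖tentElem R i * y‖`. -/
theorem tentRoot_le_self {i : ℕ} (hi : 2 ≤ i) {x : ℝ} (hx : 0 ≤ x) : tentRoot i x ≤ x := by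
  rcases le_or_gt x 1 with h | h
  · rw [tentRoot_eq_zero]
    · exact hx
    · have : (2 : ℝ) ≤ i := by exact_mod_cast hi
      rw [abs_sub_comm]
      exact (by linarith : (1 : ℝ) ≤ i - x).trans (le_abs_self _)
  · exact (tentRoot_le_one i x).trans h.le

theorem tentRoot_mul_eq_zero {i j : ℕ} (h : i + 2 ≤ j) (x : ℝ) :
    tentRoot i x * tentRoot j x = 0 := by
  have h' : (i : ℝ) + 2 ≤ j := by exact_mod_cast h
  rcases le_or_gt x (i + 1) with hx | hx
  · rw [tentRoot_eq_zero (i := j), mul_zero]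
    rw [abs_sub_comm]
    exact (by linarith : (1 : ℝ) ≤ j - x).trans (le_abs_self _)
  · rw [tentRoot_eq_zero (i := i), zero_mul]
    exact (by linarith : (1 : ℝ) ≤ x - i).trans (le_abs_self _)

theorem sum_tentRoot_mul_self {n : ℕ} {x : ℝ} (h0 : 0 ≤ x) (hn : x + 2 ≤ n) :
    ∑ i ∈ Finset.range n, tentRoot i x * tentRoot i x = 1 := by
  simp only [tentRoot_mul_self]
  set f := ⌊x⌋₊ with hf
  have h1 : (f : ℝ) ≤ x := Nat.floor_le h0
  have h2 : x < f + 1 := Nat.lt_floor_add_one x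
  have hfn : f + 1 < n := by
    have : ((f + 1 : ℕ) : ℝ) < n := by push_cast; linarith
    exact_mod_cast this
  rw [Finset.sum_eq_add_of_mem f (f + 1) (by simp; omega) (by simpa using hfn) (by omega)]
  · rw [abs_of_nonneg (by linarith), abs_of_nonpos (by push_cast; linarith),
      max_eq_right (by linarith), max_eq_right (by push_cast; linarith)]
    push_cast
    ring
  · intro c _ hc
    refine max_eq_left ?_
    rcases lt_or_gt_of_ne hc.1 with h | h
    · have : (c : ℝ) + 1 ≤ f := by exact_mod_cast h
      rw [abs_of_nonneg (by linarith)]; linarith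
    · have : (f : ℝ) + 2 ≤ c := by
        have : f + 2 ≤ c := by have := hc.2; omega
        exact_mod_cast this
      rw [abs_of_nonpos (by linarith)]; linarith

end Tents

/-! ### Compression of a family by the partition of unity. -/

section Compression

variable {N : Type*} [CStarAlgebra N]

/-- The members of a square-root partition of unity in `C*(R)`, for a positive element `R`. -/
def tentElem (R : N) (i : ℕ) : N := cfc (tentRoot i) R

theorem tentElem_isSelfAdjoint (R : N) (i : ℕ) : IsSelfAdjoint (tentElem R i) :=
  cfc_predicate _ _

theorem star_tentElem (R : N) (i : ℕ) : star (tentElem R i) = tentElem R i :=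
  (tentElem_isSelfAdjoint R i).star_eq

theorem tentElem_mul_tentElem_comm (R : N) (i j : ℕ) :
    tentElem R i * tentElem R j = tentElem R j * tentElem R i :=
  (cfc_commute_cfc (tentRoot i) (tentRoot j) R).eq

theorem norm_tentElem_le_one (R : N) (i : ℕ) : ‖tentElem R i‖ ≤ 1 :=
  norm_cfc_le zero_le_one fun x _ => by
    rw [Real.norm_of_nonneg (tentRoot_nonneg i x)]
    exact tentRoot_le_one i x

theorem tentElem_mul_tentElem_eq_zero (R : N) {i j : ℕ} (h : i + 2 ≤ j) :
    tentElem R i * tentElem R j = 0 := by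
  rw [tentElem, tentElem, ← cfc_mul _ _ R (continuous_tentRoot i).continuousOn
    (continuous_tentRoot j).continuousOn]
  simp [tentRoot_mul_eq_zero h]

theorem tentElem_mul_tentElem_eq_zero' (R : N) {i j : ℕ} (h : ¬ (i ≤ j + 1 ∧ j ≤ i + 1)) :
    tentElem R i * tentElem R j = 0 := by
  rcases le_or_gt (i + 2) j with h' | h'
  · exact tentElem_mul_tentElem_eq_zero R h'
  · rw [tentElem_mul_tentElem_comm]
    exact tentElem_mul_tentElem_eq_zero R (by omega)

/-- The compression `∑ kᵢ xᵢ kᵢ` of a family by the partition of unity. -/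
def compress (R : N) (n : ℕ) (x : ℕ → N) : N :=
  ∑ i ∈ Finset.range n, tentElem R i * x i * tentElem R i

variable [PartialOrder N] [StarOrderedRing N] {R : N} {ρ : ℝ} (h0 : 0 ≤ R) (h1 : R ≤ ρ • (1 : N))
include h0 h1

theorem tentElem_eq_zero {i : ℕ} (hi : ρ + 1 ≤ i) : tentElem R i = 0 := by
  rw [tentElem, cfc_congr (g := fun _ => (0 : ℝ)), cfc_const_zero]
  intro x hx
  have := (spectrum_subset_Icc_of_le h0 h1 hx).2
  refine tentRoot_eq_zero ?_
  rw [abs_sub_comm]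
  exact (by linarith : (1 : ℝ) ≤ i - x).trans (le_abs_self _)

theorem sum_tentElem_mul_self {n : ℕ} (hn : ρ + 2 ≤ n) :
    ∑ i ∈ Finset.range n, tentElem R i * tentElem R i = 1 := by
  have hs := spectrum_subset_Icc_of_le h0 h1
  simp only [tentElem]
  have : ∀ i, cfc (tentRoot i) R * cfc (tentRoot i) R =
      cfc (fun x => tentRoot i x * tentRoot i x) R := fun i =>
    (cfc_mul _ _ R (continuous_tentRoot i).continuousOn (continuous_tentRoot i).continuousOn).symm
  simp only [this]
  rw [← cfc_sum (R := ℝ) (fun i x => tentRoot i x * tentRoot i x) R (Finset.range n)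
    (fun i _ => ((continuous_tentRoot i).mul (continuous_tentRoot i)).continuousOn)]
  rw [cfc_congr (g := fun _ => (1 : ℝ)), cfc_const_one ℝ R]
  intro x hx
  simp only [Finset.sum_apply]
  exact sum_tentRoot_mul_self (hs hx).1 (by linarith [(hs hx).2])

theorem norm_tentElem_mul_le {i : ℕ} (hi : 2 ≤ i) (y : N) : ‖tentElem R i * y‖ ≤ ‖R * y‖ := by
  refine norm_cfc_mul_le (continuous_tentRoot i) h0 (fun x hx => ?_) y
  have := (spectrum_subset_Icc_of_le h0 h1 hx).1
  rw [abs_of_nonneg (tentRoot_nonneg i x), abs_of_nonneg this]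
  exact tentRoot_le_self hi this

theorem norm_mul_tentElem_le {i : ℕ} (hi : 2 ≤ i) (y : N) : ‖y * tentElem R i‖ ≤ ‖y * R‖ := by
  have := norm_tentElem_mul_le h0 h1 hi (star y)
  rwa [← norm_star, star_mul, star_star, star_tentElem, ← norm_star (R * star y), star_mul,
    star_star, h0.isSelfAdjoint.star_eq] at this

theorem compress_eq_of_le {n m : ℕ} (hn : ρ + 1 ≤ n) (hnm : n ≤ m) (x : ℕ → N) :
    compress R n x = compress R m x := by
  refine Finset.sum_subset (by simpa using hnm) fun i _ hi => ?_
  rw [tentElem_eq_zero h0 h1, zero_mul, zero_mul]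
  have : (n : ℝ) ≤ i := by exact_mod_cast (by simpa using hi : n ≤ i)
  linarith

theorem norm_compress_le {n : ℕ} (hn : ρ + 2 ≤ n) {x : ℕ → N} {M : ℝ} (hM : 0 ≤ M)
    (hx : ∀ i < n, ‖x i‖ ≤ M) : ‖compress R n x‖ ≤ M := by
  have h := (sum_tentElem_mul_self h0 h1 hn).le
  have h2 : ∑ i ∈ Finset.range n, star (tentElem R i) * tentElem R i ≤ 1 := by
    simpa only [star_tentElem] using h
  have := norm_sum_star_mul_mul_le (Finset.range n) (tentElem R) x (tentElem R) hM h2 h2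
    (fun i hi => hx i (by simpa using hi))
  simpa only [star_tentElem, compress] using this

/-- Inserting `∑ k j * k j = 1` compares `z' i * k i` with `k i * compress R n z'`. Only
neighbouring tents overlap, which leaves a term `x i * k i` from differences of neighbouring values
and a commutator term `y i`. The first is again summed as a compression, so its bound `M * (3 * a)`
is free of the factor `n`; this matters because `a` contains a modulus of continuity and cannot be
made small compared with `1 / n`. -/
theorem norm_compress_mul_sub_le {n : ℕ} (hn : ρ + 2 ≤ n) {z z' : ℕ → N} {M a b : ℝ}
    (hM : 0 ≤ M) (ha : 0 ≤ a) (hz : ∀ i < n, ‖z i‖ ≤ M)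
    (hcomm : ∀ i < n, ∀ j < n, ‖tentElem R i * z' j - z' j * tentElem R i‖ ≤ b)
    (hnear : ∀ i < n, ∀ j < n, i ≤ j + 1 → j ≤ i + 1 → ‖(z' i - z' j) * tentElem R j‖ ≤ a) :
    ‖compress R n (fun i => z i * z' i) - compress R n z * compress R n z'‖ ≤
      M * (3 * a) + n * (M * (n * (2 * b))) := by
  set k := tentElem R with hk
  have hk1 : ∀ i, ‖k i‖ ≤ 1 := norm_tentElem_le_one R
  have hkc : ∀ i j, k i * k j = k j * k i := tentElem_mul_tentElem_comm R
  have hone := sum_tentElem_mul_self h0 h1 hn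
  set x : ℕ → N := fun i => ∑ j ∈ Finset.range n with i ≤ j + 1 ∧ j ≤ i + 1,
    (z' i - z' j) * (k j * k j) with hxdef
  set y : ℕ → N := fun i => ∑ j ∈ Finset.range n, (z' j * k j * k i - k i * k j * z' j) * k j
    with hydef
  have hx : ∀ i < n, ‖x i‖ ≤ 3 * a := fun i hi => by
    have hcard : (Finset.filter (fun j => i ≤ j + 1 ∧ j ≤ i + 1) (Finset.range n)).card ≤ 3 := by
      refine (Finset.card_le_card (t := Finset.Icc (i - 1) (i + 1)) fun j hj => ?_).trans ?_
      · simp only [Finset.mem_filter] at hj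
        simp only [Finset.mem_Icc]
        omega
      · rw [Nat.card_Icc]; omega
    refine (norm_sum_le_of_le _ (n := fun _ => a) fun j hj => ?_).trans ?_
    · simp only [Finset.mem_filter, Finset.mem_range] at hj
      rw [← mul_assoc]
      calc _ ≤ ‖(z' i - z' j) * k j‖ * ‖k j‖ := norm_mul_le _ _
        _ ≤ a * 1 := mul_le_mul (hnear i hi j hj.1 hj.2.1 hj.2.2) (hk1 j) (norm_nonneg _) ha
        _ = a := mul_one a
    · rw [Finset.sum_const, nsmul_eq_mul]
      gcongr
      exact_mod_cast hcard
  have hy : ∀ i < n, ‖y i‖ ≤ n * (2 * b) := fun i hi => by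
    refine (norm_sum_le_of_le _ (n := fun _ => 2 * b) fun j hj => ?_).trans (by simp)
    rw [Finset.mem_range] at hj
    have e : z' j * k j * k i - k i * k j * z' j =
        -((k j * z' j - z' j * k j) * k i) - k j * (k i * z' j - z' j * k i) := by
      rw [hkc i j]
      noncomm_ring
    have hj1 := hcomm j hj j hj
    have hj2 := hcomm i hi j hj
    have hb : 0 ≤ b := (norm_nonneg _).trans hj1
    calc _ ≤ ‖z' j * k j * k i - k i * k j * z' j‖ * ‖k j‖ := norm_mul_le _ _
      _ ≤ ‖z' j * k j * k i - k i * k j * z' j‖ * 1 := by gcongr; exact hk1 j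
      _ ≤ ‖k j * z' j - z' j * k j‖ * ‖k i‖ + ‖k j‖ * ‖k i * z' j - z' j * k i‖ := by
          rw [mul_one, e]
          refine (norm_sub_le _ _).trans ?_
          rw [norm_neg]
          exact add_le_add (norm_mul_le _ _) (norm_mul_le _ _)
      _ ≤ b * 1 + 1 * b := by
          gcongr
          exacts [hk1 i, hk1 j]
      _ = 2 * b := by ring
  have hdecomp : ∀ i, z' i * k i - k i * compress R n z' = x i * k i + y i := fun i => by
    have e1 : x i * k i = ∑ j ∈ Finset.range n, (z' i - z' j) * (k j * k j) * k i := by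
      rw [hxdef, Finset.sum_mul, Finset.sum_filter]
      refine Finset.sum_congr rfl fun j _ => ?_
      split_ifs with h
      · rfl
      · have : k j * k i = 0 := tentElem_mul_tentElem_eq_zero' R (by tauto)
        simp only [mul_assoc, this, mul_zero]
    have e2 : z' i * k i = ∑ j ∈ Finset.range n, z' i * (k j * k j) * k i := by
      rw [← Finset.sum_mul, ← Finset.mul_sum, hone, mul_one]
    rw [e1, e2, compress, Finset.mul_sum, hydef, ← Finset.sum_sub_distrib,
      ← Finset.sum_add_distrib]
    refine Finset.sum_congr rfl fun j _ => ?_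
    change _ - k i * (k j * z' j * k j) = _
    have e3 : z' j * k j * k i * k j = z' j * (k j * k j) * k i := by
      simp only [mul_assoc, hkc i j]
    rw [sub_mul (z' j * k j * k i), e3, sub_mul, sub_mul]
    simp only [mul_assoc]
    abel
  have e : compress R n (fun i => z i * z' i) - compress R n z * compress R n z' =
      (∑ i ∈ Finset.range n, k i * (z i * x i) * k i) +
        ∑ i ∈ Finset.range n, k i * z i * y i := by
    rw [compress, compress, Finset.sum_mul, ← Finset.sum_sub_distrib, ← Finset.sum_add_distrib]
    refine Finset.sum_congr rfl fun i _ => ?_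
    have : k i * (z i * z' i) * k i - k i * z i * k i * compress R n z' =
        k i * z i * (z' i * k i - k i * compress R n z') := by
      simp only [mul_sub, mul_assoc]
    rw [← hk, this, hdecomp]
    simp only [mul_add, mul_assoc]
  rw [e]
  refine (norm_add_le _ _).trans (add_le_add ?_ ?_)
  · refine norm_compress_le h0 h1 hn (x := fun i => z i * x i) (by positivity) fun i hi => ?_
    exact (norm_mul_le _ _).trans (mul_le_mul (hz i hi) (hx i hi) (norm_nonneg _) hM)
  · refine (norm_sum_le_of_le _ (n := fun _ => M * (n * (2 * b))) fun i hi => ?_).trans (by simp)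
    rw [Finset.mem_range] at hi
    refine (norm_mul_le _ _).trans (mul_le_mul ?_ (hy i hi) (norm_nonneg _) hM)
    calc _ ≤ ‖k i‖ * ‖z i‖ := norm_mul_le _ _
      _ ≤ 1 * M := mul_le_mul (hk1 i) (hz i hi) (norm_nonneg _) zero_le_one
      _ = M := one_mul M

end Compression

theorem exists_pos_forall_lt_le (n : ℕ) (f : ℕ → ℝ) (hf : ∀ i, 0 < f i) :
    ∃ δ > 0, ∀ i < n, δ ≤ f i := by
  have h : ∀ᶠ δ in 𝓝[>] (0 : ℝ), ∀ i ∈ Finset.range n, δ ≤ f i := by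
    rw [Finset.eventually_all]
    intro i _
    filter_upwards [Ioc_mem_nhdsGT (hf i)] with δ hδ using hδ.2
  obtain ⟨δ, h1, h2⟩ := (h.and self_mem_nhdsWithin).exists
  exact ⟨δ, h2, fun i hi => h1 i (by simpa using hi)⟩

/-! ### Continuous paths of quasicentral elements. -/

section Admissible

variable {N : Type*} [CStarAlgebra N] [PartialOrder N]

/-- Complements of members of `J` that commute with `K` and annihilate `Y` up to `δ`. -/
def admissible (J : Ideal N) (K Y : Set N) (δ : ℝ) : Set N :=
  {w | 0 ≤ w ∧ w ≤ 1 ∧ 1 - w ∈ J ∧ (∀ x ∈ K, ‖w * x - x * w‖ ≤ δ) ∧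
    ∀ y ∈ Y, ‖w * y‖ ≤ δ ∧ ‖y * w‖ ≤ δ}

theorem convex_setOf_norm_le {E F : Type*} [AddCommGroup E] [Module ℝ E]
    [SeminormedAddCommGroup F] [NormedSpace ℝ F] (f : E →ₗ[ℝ] F) (δ : ℝ) :
    Convex ℝ {x | ‖f x‖ ≤ δ} := by
  have : {x | ‖f x‖ ≤ δ} = f ⁻¹' Metric.closedBall 0 δ := by ext; simp
  rw [this]
  exact (convex_closedBall 0 δ).linear_preimage f

variable [StarOrderedRing N]

/-- Convexity allows a partition of unity on the line to interpolate between admissible elements. -/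
theorem convex_admissible (J : Ideal N) (K Y : Set N) (δ : ℝ) :
    Convex ℝ (admissible J K Y δ) := by
  have h1 : Convex ℝ {w : N | 1 - w ∈ J} := by
    intro a ha b hb s t _ _ hst
    have : 1 - (s • a + t • b) = (s • (1 : N)) * (1 - a) + (t • (1 : N)) * (1 - b) := by
      rw [smul_mul_assoc, one_mul, smul_mul_assoc, one_mul, smul_sub, smul_sub]
      have : (1 : N) = s • 1 + t • 1 := by rw [← add_smul, hst, one_smul]
      nth_rw 1 [this]
      abel
    change 1 - (s • a + t • b) ∈ J
    rw [this]
    exact J.add_mem (J.mul_mem_left _ ha) (J.mul_mem_left _ hb)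
  have h2 : ∀ x : N, Convex ℝ {w : N | ‖w * x - x * w‖ ≤ δ} := fun x => by
    simpa using convex_setOf_norm_le (LinearMap.mulRight ℝ x - LinearMap.mulLeft ℝ x) δ
  have h3 : ∀ x : N, Convex ℝ {w : N | ‖w * x‖ ≤ δ} := fun x => by
    simpa using convex_setOf_norm_le (LinearMap.mulRight ℝ x) δ
  have h4 : ∀ x : N, Convex ℝ {w : N | ‖x * w‖ ≤ δ} := fun x => by
    simpa using convex_setOf_norm_le (LinearMap.mulLeft ℝ x) δ
  have : admissible J K Y δ = Set.Ici 0 ∩ (Set.Iic 1 ∩ ({w : N | 1 - w ∈ J} ∩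
      ((⋂ x ∈ K, {w : N | ‖w * x - x * w‖ ≤ δ}) ∩
        ⋂ y ∈ Y, ({w : N | ‖w * y‖ ≤ δ} ∩ {w : N | ‖y * w‖ ≤ δ})))) := by
    ext w
    simp [admissible]
  rw [this]
  exact (convex_Ici 0).inter ((convex_Iic 1).inter (h1.inter
    ((convex_iInter₂ fun x _ => h2 x).inter (convex_iInter₂ fun y _ => (h3 y).inter (h4 y)))))

theorem exists_mem_admissible {J : Ideal N} [J.IsTwoSided] (hJ : HasIncreasingApproxUnit J)
    {K Y : ℕ → Set N} {δ : ℕ → ℝ} (hK : ∀ n, IsCompact (K n)) (hY : ∀ n, (Y n).Finite)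
    (hYJ : ∀ n, Y n ⊆ J) (hδ : ∀ n, 0 < δ n) (n : ℕ) :
    ∃ w, ∀ k ≤ n, w ∈ admissible J (K k) (Y k) (δ k) := by
  obtain ⟨ε, hε, hle⟩ := exists_pos_forall_lt_le (n + 1) δ hδ
  obtain ⟨w, h0, h1, h2, h3, h4⟩ := exists_quasicentral hJ
    (K := ⋃ k ∈ Set.Iic n, K k) (Y := ⋃ k ∈ Set.Iic n, Y k)
    ((Set.finite_Iic n).isCompact_biUnion fun k _ => hK k)
    ((Set.finite_Iic n).biUnion fun k _ => hY k)
    (Set.iUnion₂_subset fun k _ => hYJ k) hε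
  refine ⟨w, fun k hk => ⟨h0, h1, h2, fun x hx => ?_, fun y hy => ?_⟩⟩
  · exact (h3 x (Set.mem_biUnion (Set.mem_Iic.2 hk) hx)).trans (hle k (by omega))
  · have := h4 y (Set.mem_biUnion (Set.mem_Iic.2 hk) hy)
    exact ⟨this.1.trans (hle k (by omega)), this.2.trans (hle k (by omega))⟩

omit [PartialOrder N] [StarOrderedRing N] in
/-- A path that stays in the `n`-th convex set from time `n` on. -/
theorem exists_path_forall_mem {P : ℕ → Set N} (hP : ∀ n, Convex ℝ (P n))
    (hne : ∀ n, ∃ w, ∀ k ≤ n, w ∈ P k) :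
    ∃ w : C(ℝ, N), ∀ (n : ℕ) (t : ℝ), n ≤ t → w t ∈ P n := by
  obtain ⟨w, hw⟩ := exists_continuous_forall_mem_convex_of_local_const
    (t := fun t : ℝ => ⋂ n ∈ {n : ℕ | (n : ℝ) ≤ t}, P n)
    (fun t => convex_iInter₂ fun n _ => hP n) (fun t => by
      -- An element good for all indices up to `t + 1` serves every `s < t + 1`, hence a whole
      -- neighbourhood of `t`.
      obtain ⟨c, hc⟩ := hne ⌈t + 1⌉₊
      refine ⟨c, ?_⟩
      filter_upwards [Iio_mem_nhds (lt_add_one t)] with s hs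
      refine Set.mem_iInter₂.2 fun n hn => hc n ?_
      have h1 : (n : ℝ) ≤ s := hn
      have h2 : s < t + 1 := hs
      have := Nat.le_ceil (t + 1)
      exact_mod_cast (by linarith : (n : ℝ) ≤ ⌈t + 1⌉₊))
  exact ⟨w, fun n t h => Set.mem_iInter₂.1 (hw t) n h⟩

/-- Almost commuting passes from `w` to the tents by polynomial approximation. For the second half,
subtract from `x` an element of `J` that nearly realises the quotient norm: the difference has norm
about that of the class of `x`, and the element of `J` is nearly killed by `w`, hence by every tent
with `2 ≤ i`. -/
theorem exists_admissible_tentElem {J : Ideal N} [J.IsTwoSided] {L D : Set N} (hL : IsCompact L)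
    (hD : IsCompact D) {ρ : ℝ} (hρ : 0 ≤ ρ) (n : ℕ) {ε : ℝ} (hε : 0 < ε) :
    ∃ (K Y : Set N) (δ : ℝ), IsCompact K ∧ Y.Finite ∧ Y ⊆ J ∧ 0 < δ ∧
      ∀ w ∈ admissible J K Y δ, ∀ r ∈ Set.Icc 0 ρ,
        (∀ i < n, ∀ x ∈ L, ‖tentElem (r • w) i * x - x * tentElem (r • w) i‖ ≤ ε) ∧
        ∀ i, 2 ≤ i → ∀ x ∈ D, ‖tentElem (r • w) i * x‖ ≤ ‖Ideal.Quotient.mk J x‖ + ε ∧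
          ‖x * tentElem (r • w) i‖ ≤ ‖Ideal.Quotient.mk J x‖ + ε := by
  obtain ⟨M, hM0, hM⟩ : ∃ M : ℝ, 0 ≤ M ∧ ∀ x ∈ L, ‖x‖ ≤ M := by
    obtain ⟨M, hM⟩ := hL.isBounded.exists_norm_le
    exact ⟨max M 0, le_max_right _ _, fun x hx => (hM x hx).trans (le_max_left _ _)⟩
  choose δ hδ0 hδ using fun i => exists_norm_commutator_cfc_le (N := N) (tentRoot i)
    (continuous_tentRoot i) ρ hρ hε hM0
  obtain ⟨δ', hδ'0, hδ'⟩ := exists_pos_forall_lt_le n δ hδ0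
  have hlift : ∀ x : N, ∃ y ∈ J, ‖x - y‖ ≤ ‖Ideal.Quotient.mk J x‖ + ε / 6 := fun x => by
    obtain ⟨m, hm, hlt⟩ := Submodule.Quotient.norm_mk_lt (S := J) (Ideal.Quotient.mk J x)
      (show 0 < ε / 6 by positivity)
    refine ⟨x - m, ?_, by simpa using hlt.le⟩
    exact (Submodule.Quotient.eq J).1 hm.symm
  choose y hyJ hy using hlift
  -- Three errors `ε / 6` arise: distance to the net, its effect on the quotient norm, and the
  -- choice of the element of `J`. The remaining `ε / 2` is for annihilating that element; dividing
  -- by `ρ + 1` absorbs the scaling by `r ≤ ρ`.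
  obtain ⟨t, -, ht, hDt⟩ := hD.finite_cover_balls (e := ε / 6) (by positivity)
  refine ⟨L, y '' t, min (δ' / (ρ + 1)) (ε / 2 / (ρ + 1)), hL, ht.image y, ?_,
    lt_min (by positivity) (by positivity), fun w hw r hr => ?_⟩
  · rintro _ ⟨x, -, rfl⟩
    exact hyJ x
  obtain ⟨h0, h1, -, hc, hY⟩ := hw
  have hR0 : 0 ≤ r • w := smul_nonneg hr.1 h0
  have hR1 : r • w ≤ ρ • (1 : N) :=
    (smul_le_smul_of_nonneg_left h1 hr.1).trans (smul_le_smul_of_nonneg_right hr.2 zero_le_one)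
  have hscale : ∀ {a e : ℝ}, 0 ≤ a → 0 ≤ e → a ≤ e / (ρ + 1) → r * a ≤ e := by
    intro a e ha he h
    rw [le_div_iff₀ (by positivity)] at h
    nlinarith [hr.2, hr.1]
  constructor
  · intro i hi x hx
    refine hδ i _ x hR0 hR1 (hM x hx) ?_
    rw [smul_mul_assoc, mul_smul_comm, ← smul_sub, norm_smul, Real.norm_of_nonneg hr.1]
    exact (hscale (norm_nonneg _) hδ'0.le ((hc x hx).trans (min_le_left _ _))).trans (hδ' i hi)
  · intro i hi x hx
    obtain ⟨x', hx', hxx⟩ := Set.mem_iUnion₂.1 (hDt hx)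
    rw [Metric.mem_ball, dist_eq_norm] at hxx
    have hq : ‖Ideal.Quotient.mk J x'‖ ≤ ‖Ideal.Quotient.mk J x‖ + ε / 6 := by
      have e : Ideal.Quotient.mk J x' =
          Ideal.Quotient.mk J x - Ideal.Quotient.mk J (x - x') := by
        rw [map_sub]; abel
      rw [e]
      refine (norm_sub_le _ _).trans (add_le_add le_rfl ?_)
      exact (Submodule.Quotient.norm_mk_le J (x - x')).trans hxx.le
    have hd : ‖x - y x'‖ ≤ ‖Ideal.Quotient.mk J x‖ + ε / 2 := by
      have := norm_add_le (x - x') (x' - y x')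
      rw [sub_add_sub_cancel] at this
      have := hy x'
      linarith
    obtain ⟨hw1, hw2⟩ := hY _ (Set.mem_image_of_mem y hx')
    have hk := norm_tentElem_le_one (r • w) i
    constructor
    · have e : tentElem (r • w) i * x =
          tentElem (r • w) i * (x - y x') + tentElem (r • w) i * y x' := by rw [mul_sub]; abel
      have h5 : ‖tentElem (r • w) i * y x'‖ ≤ ε / 2 := by
        refine (norm_tentElem_mul_le hR0 hR1 hi _).trans ?_
        rw [smul_mul_assoc, norm_smul, Real.norm_of_nonneg hr.1]
        exact hscale (norm_nonneg _) (by positivity) (hw1.trans (min_le_right _ _))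
      have h6 : ‖tentElem (r • w) i * (x - y x')‖ ≤ ‖x - y x'‖ :=
        (norm_mul_le _ _).trans (mul_le_of_le_one_left (norm_nonneg _) hk)
      rw [e]
      exact (norm_add_le _ _).trans (by linarith)
    · have e : x * tentElem (r • w) i =
          (x - y x') * tentElem (r • w) i + y x' * tentElem (r • w) i := by rw [sub_mul]; abel
      have h5 : ‖y x' * tentElem (r • w) i‖ ≤ ε / 2 := by
        refine (norm_mul_tentElem_le hR0 hR1 hi _).trans ?_
        rw [mul_smul_comm, norm_smul, Real.norm_of_nonneg hr.1]
        exact hscale (norm_nonneg _) (by positivity) (hw2.trans (min_le_right _ _))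
      have h6 : ‖(x - y x') * tentElem (r • w) i‖ ≤ ‖x - y x'‖ :=
        (norm_mul_le _ _).trans (mul_le_of_le_one_right (norm_nonneg _) hk)
      rw [e]
      exact (norm_add_le _ _).trans (by linarith)

/-- A path of quasicentral elements, good on the `n`-th pair of compact sets from time `n` on. -/
theorem exists_quasicentral_path {J : Ideal N} [J.IsTwoSided] (hJ : HasIncreasingApproxUnit J)
    {L D : ℕ → Set N} (hL : ∀ n, IsCompact (L n)) (hD : ∀ n, IsCompact (D n)) {ρ ε : ℕ → ℝ}
    (hρ : ∀ n, 0 ≤ ρ n) (hε : ∀ n, 0 < ε n) (m : ℕ → ℕ) :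
    ∃ w : C(ℝ, N), (∀ t, 0 ≤ t → 0 ≤ w t ∧ w t ≤ 1 ∧ 1 - w t ∈ J) ∧
      ∀ (n : ℕ) (t : ℝ), n ≤ t → ∀ r ∈ Set.Icc 0 (ρ n),
        (∀ i < m n, ∀ x ∈ L n,
          ‖tentElem (r • w t) i * x - x * tentElem (r • w t) i‖ ≤ ε n) ∧
        ∀ i, 2 ≤ i → ∀ x ∈ D n,
          ‖tentElem (r • w t) i * x‖ ≤ ‖Ideal.Quotient.mk J x‖ + ε n ∧
          ‖x * tentElem (r • w t) i‖ ≤ ‖Ideal.Quotient.mk J x‖ + ε n := by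
  choose K Y δ hK hY hYJ hδ hadm using fun n =>
    exists_admissible_tentElem (J := J) (hL n) (hD n) (hρ n) (m n) (hε n)
  obtain ⟨w, hw⟩ := exists_path_forall_mem (fun n => convex_admissible J (K n) (Y n) (δ n))
    (exists_mem_admissible hJ hK hY hYJ hδ)
  refine ⟨w, fun t ht => ?_, fun n t hnt => hadm n _ (hw n t hnt)⟩
  have := hw 0 t (by simpa using ht)
  exact ⟨this.1, this.2.1, this.2.2.1⟩

end Admissible

/-! ### Nodes of the moving partition of the unit interval. -/

section NodePositions

/-- The position in the unit interval of the `i`-th node of the partition used at time `t`. -/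
def nodePos (t : ℝ) (i : ℕ) : unitInterval :=
  Set.projIcc 0 1 zero_le_one (3 * ((i : ℝ) - 2) / (t + 4))

theorem nodePos_eq_zero {t : ℝ} (ht : 1 ≤ t) {i : ℕ} (hi : i ≤ 2) : nodePos t i = 0 := by
  refine Set.projIcc_of_le_left _ ?_
  have : (i : ℝ) ≤ 2 := by exact_mod_cast hi
  exact div_nonpos_of_nonpos_of_nonneg (by linarith) (by linarith)

/-- A tent that is nonzero at `t + 4` is centred beyond `t + 3`, and `3 * (t + 1) ≥ t + 4` for `t ≥
1`. As `t + 4` is the value of `R` modulo the ideal, these are the only tents seen in the quotient.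
-/
theorem nodePos_eq_one {t : ℝ} (ht : 1 ≤ t) {i : ℕ} (hi : tentRoot i (t + 4) ≠ 0) :
    nodePos t i = 1 := by
  refine Set.projIcc_of_right_le _ ?_
  have h : |t + 4 - i| < 1 := by
    by_contra h
    exact hi (tentRoot_eq_zero (not_lt.1 h))
  have := (abs_lt.1 h).2
  rw [le_div_iff₀ (by linarith)]
  linarith

theorem continuousOn_nodePos (i : ℕ) : ContinuousOn (fun t => nodePos t i) (Set.Ici 1) := by
  refine continuous_projIcc.comp_continuousOn ?_
  refine ContinuousOn.div (by fun_prop) (by fun_prop) fun t ht => ?_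
  have : (1 : ℝ) ≤ t := ht
  linarith

theorem dist_nodePos_le {t : ℝ} (ht : 1 ≤ t) {i j : ℕ} (h1 : i ≤ j + 1) (h2 : j ≤ i + 1) :
    dist (nodePos t i) (nodePos t j) ≤ 3 / (t + 4) := by
  refine ((LipschitzWith.projIcc zero_le_one).dist_le_mul _ _).trans ?_
  rw [NNReal.coe_one, one_mul, Real.dist_eq, ← sub_div, abs_div,
    abs_of_pos (by linarith : 0 < t + 4)]
  refine div_le_div_of_nonneg_right ?_ (by linarith)
  have h1' : (i : ℝ) ≤ j + 1 := by exact_mod_cast h1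
  have h2' : (j : ℝ) ≤ i + 1 := by exact_mod_cast h2
  rw [abs_le]
  constructor <;> linarith

end NodePositions

/-! ### The asymptotic compression and its multiplicativity. -/

section AsymptoticCompression

variable {N : Type*} [CStarAlgebra N]

theorem mk_aeval_eq {J : Ideal N} [J.IsTwoSided] {R : N} {ρ : ℝ} (hR : R - ρ • (1 : N) ∈ J)
    (p : Polynomial ℝ) : Polynomial.aeval R p - p.eval ρ • (1 : N) ∈ J := by
  rw [← Ideal.Quotient.mk_eq_mk_iff_sub_mem] at hR ⊢
  have e : p.eval ρ • (1 : N) = Polynomial.aeval (ρ • (1 : N)) p := by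
    rw [← Algebra.algebraMap_eq_smul_one, ← Algebra.algebraMap_eq_smul_one,
      Polynomial.aeval_algebraMap_apply, Polynomial.coe_aeval_eq_eval]
  rw [e, Polynomial.aeval_def, Polynomial.aeval_def, Polynomial.hom_eval₂, Polynomial.hom_eval₂, hR]

/-- The linear map `z ↦ ∑ kᵢ z(sᵢ, t) kᵢ`. -/
def asymptoticCompression (w : ℝ → N) (t : ℝ) : (unitInterval × ℝ →ᵇ N) →ₗ[ℂ] N where
  -- As `R ≤ t + 4`, the tents sum to one once there are at least `t + 6` of them; `⌈t⌉₊ + 7` is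
  -- enough.
  toFun z := compress ((t + 4) • w t) (⌈t⌉₊ + 7) fun i => z (nodePos t i, t)
  map_add' z z' := by
    simp only [compress, BoundedContinuousFunction.add_apply, mul_add, add_mul,
      Finset.sum_add_distrib]
  map_smul' c z := by
    simp only [compress, BoundedContinuousFunction.smul_apply, mul_smul_comm, smul_mul_assoc,
      Finset.smul_sum, RingHom.id_apply]

theorem asymptoticCompression_apply (w : ℝ → N) (t : ℝ) (z : unitInterval × ℝ →ᵇ N) :
    asymptoticCompression w t z =
      compress ((t + 4) • w t) (⌈t⌉₊ + 7) fun i => z (nodePos t i, t) := rfl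

theorem asymptoticCompression_star (w : ℝ → N) (t : ℝ) (z : unitInterval × ℝ →ᵇ N) :
    asymptoticCompression w t (star z) = star (asymptoticCompression w t z) := by
  simp only [asymptoticCompression_apply, compress, star_sum, star_mul, star_tentElem,
    BoundedContinuousFunction.star_apply, mul_assoc]

variable [PartialOrder N] [StarOrderedRing N]

/-- Modulo `J` the element `R` is the scalar `ρ`, so a polynomial in `R` becomes its value at `ρ`.
Uniform approximation on `[0, ρ]` and closedness of `J` extend this to `f`. -/
theorem cfc_sub_smul_one_mem {J : Ideal N} [J.IsTwoSided] (hJ : IsClosed (J : Set N))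
    {f : ℝ → ℝ} (hf : Continuous f) {R : N} {ρ : ℝ} (hρ : 0 ≤ ρ) (h0 : 0 ≤ R)
    (h1 : R ≤ ρ • (1 : N)) (hR : R - ρ • (1 : N) ∈ J) : cfc f R - f ρ • (1 : N) ∈ J := by
  change _ ∈ (J : Set N)
  rw [← hJ.closure_eq, Metric.mem_closure_iff]
  intro ε hε
  obtain ⟨p, hp⟩ := exists_polynomial_near_of_continuousOn 0 ρ f hf.continuousOn (ε / 3)
    (by positivity)
  refine ⟨_, mk_aeval_eq hR p, ?_⟩
  have hd : ‖cfc f R - Polynomial.aeval R p‖ ≤ ε / 3 := by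
    have : Polynomial.aeval R p = cfc p.eval R := (cfc_polynomial p R h0.isSelfAdjoint).symm
    rw [this, ← cfc_sub f p.eval R hf.continuousOn (by fun_prop)]
    refine norm_cfc_le (by positivity) fun y hy => ?_
    rw [Real.norm_eq_abs, abs_sub_comm]
    exact (hp y (spectrum_subset_Icc_of_le h0 h1 hy)).le
  have hs : ‖(p.eval ρ - f ρ) • (1 : N)‖ ≤ ε / 3 := by
    rw [norm_smul]
    have h1' : ‖(1 : N)‖ ≤ 1 := norm_le_one_of_le_one zero_le_one le_rfl
    have := (hp ρ ⟨hρ, le_rfl⟩).le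
    exact (mul_le_of_le_one_right (norm_nonneg _) h1').trans this
  rw [dist_eq_norm]
  have e : cfc f R - f ρ • (1 : N) - (Polynomial.aeval R p - p.eval ρ • (1 : N)) =
      (cfc f R - Polynomial.aeval R p) + (p.eval ρ - f ρ) • (1 : N) := by
    rw [sub_smul]; abel
  rw [e]
  exact (norm_add_le _ _).trans_lt (by linarith)

theorem scaled_nonneg_le {w : N} {r : ℝ} (hr : 0 ≤ r) (h0 : 0 ≤ w) (h1 : w ≤ 1) :
    0 ≤ r • w ∧ r • w ≤ r • (1 : N) :=
  ⟨smul_nonneg hr h0, smul_le_smul_of_nonneg_left h1 hr⟩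

section Path

variable {J : Ideal N} {w : C(ℝ, N)}
  (hw : ∀ t, 0 ≤ t → 0 ≤ w t ∧ w t ≤ 1 ∧ 1 - w t ∈ J)
include hw

theorem norm_asymptoticCompression_le {t : ℝ} (ht : 1 ≤ t) (z : unitInterval × ℝ →ᵇ N) :
    ‖asymptoticCompression w t z‖ ≤ ‖z‖ := by
  obtain ⟨h0, h1, -⟩ := hw t (by linarith)
  obtain ⟨h0', h1'⟩ := scaled_nonneg_le (r := t + 4) (by linarith) h0 h1
  refine norm_compress_le h0' h1' ?_ (norm_nonneg _) fun i _ => z.norm_coe_le_norm _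
  have := Nat.le_ceil t
  push_cast
  linarith

theorem continuousOn_asymptoticCompression (z : unitInterval × ℝ →ᵇ N) :
    ContinuousOn (fun t => asymptoticCompression w t z) (Set.Ici 1) := by
  intro t₀ ht₀
  have ht₀' : (1 : ℝ) ≤ t₀ := ht₀
  have hev : ∀ᶠ t in 𝓝[Set.Ici 1] t₀, 1 ≤ t ∧ t ≤ t₀ + 1 :=
    eventually_mem_nhdsWithin.and (eventually_nhdsWithin_of_eventually_nhds
      (Iic_mem_nhds (lt_add_one t₀)))
  -- Superfluous tents vanish on the spectrum, so near `t₀` the number of terms can be frozen, which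
  -- removes the jumps of the ceiling.
  have heq : ∀ t, 1 ≤ t → t ≤ t₀ + 1 → asymptoticCompression w t z =
      compress ((t + 4) • w t) (⌈t₀⌉₊ + 8) fun i => z (nodePos t i, t) := by
    intro t ht1 ht2
    obtain ⟨h0, h1, -⟩ := hw t (by linarith)
    obtain ⟨h0', h1'⟩ := scaled_nonneg_le (r := t + 4) (by linarith) h0 h1
    refine compress_eq_of_le h0' h1' ?_ ?_ _
    · have := Nat.le_ceil t
      push_cast
      linarith
    · have : ⌈t⌉₊ ≤ ⌈t₀ + 1⌉₊ := Nat.ceil_mono ht2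
      rw [Nat.ceil_add_one (by linarith)] at this
      omega
  have hc : ContinuousWithinAt
      (fun t => compress ((t + 4) • w t) (⌈t₀⌉₊ + 8) fun i => z (nodePos t i, t))
      (Set.Ici 1) t₀ := by
    unfold compress
    refine tendsto_finsetSum _ fun i _ => ?_
    have hk : ContinuousWithinAt (fun t => tentElem ((t + 4) • w t) i) (Set.Ici 1) t₀ := by
      refine ContinuousWithinAt.cfc (s := Set.Icc 0 (t₀ + 5)) isCompact_Icc (tentRoot i)
        ht₀ (Continuous.continuousWithinAt (by fun_prop)) ?_ ?_ (continuous_tentRoot i).continuousOn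
      · filter_upwards [hev] with t ht
        obtain ⟨h0, h1, -⟩ := hw t (by linarith [ht.1])
        obtain ⟨h0', h1'⟩ := scaled_nonneg_le (r := t + 4) (by linarith [ht.1]) h0 h1
        exact (spectrum_subset_Icc_of_le h0' h1').trans
          (Set.Icc_subset_Icc le_rfl (by linarith [ht.2]))
      · filter_upwards [hev] with t ht
        obtain ⟨h0, h1, -⟩ := hw t (by linarith [ht.1])
        exact (scaled_nonneg_le (r := t + 4) (by linarith [ht.1]) h0 h1).1.isSelfAdjoint
    have hz : ContinuousWithinAt (fun t => z (nodePos t i, t)) (Set.Ici 1) t₀ :=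
      z.continuous.continuousAt.comp_continuousWithinAt
        ((continuousOn_nodePos i t₀ ht₀).prodMk continuousWithinAt_id)
    exact (hk.mul hz).mul hk
  refine hc.congr_of_eventuallyEq ?_ (heq t₀ ht₀' (by linarith))
  filter_upwards [hev] with t ht using heq t ht.1 ht.2

theorem asymptoticCompression_sub_mem [J.IsTwoSided] (hJ : IsClosed (J : Set N)) {t : ℝ}
    (ht : 1 ≤ t) (z : unitInterval × ℝ →ᵇ N) :
    asymptoticCompression w t z - z (1, t) ∈ J := by
  obtain ⟨h0, h1, hm⟩ := hw t (by linarith)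
  obtain ⟨h0', h1'⟩ := scaled_nonneg_le (r := t + 4) (by linarith) h0 h1
  have hR : (t + 4) • w t - (t + 4) • (1 : N) ∈ J := by
    have : (t + 4) • w t - (t + 4) • (1 : N) = (-((t + 4) • (1 : N))) * (1 - w t) := by
      rw [neg_mul, smul_mul_assoc, one_mul, smul_sub]; abel
    rw [this]
    exact J.mul_mem_left _ hm
  have hk : ∀ i, Ideal.Quotient.mk J (tentElem ((t + 4) • w t) i) =
      Ideal.Quotient.mk J (tentRoot i (t + 4) • (1 : N)) := fun i =>
    (Ideal.Quotient.mk_eq_mk_iff_sub_mem _ _).2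
      (cfc_sub_smul_one_mem hJ (continuous_tentRoot i) (by linarith) h0' h1' hR)
  rw [← Ideal.Quotient.mk_eq_mk_iff_sub_mem, asymptoticCompression_apply, compress, map_sum]
  have hterm : ∀ i ∈ Finset.range (⌈t⌉₊ + 7), Ideal.Quotient.mk J
      (tentElem ((t + 4) • w t) i * z (nodePos t i, t) * tentElem ((t + 4) • w t) i) =
      Ideal.Quotient.mk J ((tentRoot i (t + 4) * tentRoot i (t + 4)) • z (1, t)) := by
    intro i _
    rw [map_mul, map_mul, hk, ← map_mul, ← map_mul, smul_mul_assoc, one_mul, mul_smul_comm,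
      mul_one, smul_smul]
    by_cases h : tentRoot i (t + 4) = 0
    · rw [h]; simp
    · rw [nodePos_eq_one ht h]
  rw [Finset.sum_congr rfl hterm, ← map_sum, ← Finset.sum_smul,
    sum_tentRoot_mul_self (by linarith), one_smul]
  have := Nat.le_ceil t
  push_cast
  linarith

end Path

omit [PartialOrder N] [StarOrderedRing N] in
-- Only the tents `0` and `1` escape the hypothesis, and both have their node at `0`.
theorem norm_asymptoticCompression_le_of_ideal {w : C(ℝ, N)} {t : ℝ} (ht : 1 ≤ t)
    {y : unitInterval × ℝ →ᵇ N} {ε : ℝ} (hε : 0 ≤ ε)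
    (hy : ∀ i, 2 ≤ i → ‖tentElem ((t + 4) • w t) i * y (nodePos t i, t)‖ ≤ ε) :
    ‖asymptoticCompression w t y‖ ≤ 2 * ‖y (0, t)‖ + ((⌈t⌉₊ + 7 : ℕ) : ℝ) * ε := by
  rw [asymptoticCompression_apply, compress]
  have hk := norm_tentElem_le_one ((t + 4) • w t)
  have hterm : ∀ i ∈ Finset.range (⌈t⌉₊ + 7), ‖tentElem ((t + 4) • w t) i * y (nodePos t i, t) *
      tentElem ((t + 4) • w t) i‖ ≤ (if i < 2 then ‖y (0, t)‖ else 0) + ε := by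
    intro i _
    refine (norm_mul_le _ _).trans ((mul_le_of_le_one_right (norm_nonneg _) (hk i)).trans ?_)
    split_ifs with h
    · rw [nodePos_eq_zero ht h.le]
      refine (norm_mul_le _ _).trans ((mul_le_of_le_one_left (norm_nonneg _) (hk i)).trans ?_)
      linarith
    · rw [zero_add]
      exact hy i (not_lt.1 h)
  refine (norm_sum_le_of_le _ hterm).trans ?_
  rw [Finset.sum_add_distrib, ← Finset.sum_filter, Finset.sum_const, Finset.sum_const,
    Finset.card_range, nsmul_eq_mul, nsmul_eq_mul]
  refine add_le_add (mul_le_mul_of_nonneg_right ?_ (norm_nonneg _)) le_rfl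
  have : (Finset.filter (fun i => i < 2) (Finset.range (⌈t⌉₊ + 7))).card ≤ (Finset.range 2).card :=
    Finset.card_le_card fun i hi => by simpa using (Finset.mem_filter.1 hi).2
  exact_mod_cast this.trans_eq (Finset.card_range 2)

/-- The analytic core: a family of contractions `Π_t` on bounded functions on `[0, 1] × ℝ`, whose
class modulo `J` is evaluation at `1`, that is asymptotically multiplicative on a given sequence
and asymptotically annihilates a given sequence of `J`-valued functions. -/
theorem exists_asymptotic_compression {J : Ideal N} [J.IsTwoSided] (hJc : IsClosed (J : Set N))
    (hJ : HasIncreasingApproxUnit J) (z y : ℕ → unitInterval × ℝ →ᵇ N)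
    (hz : ∀ n s t, z n (s, t) - z n (s, 1) ∈ J) (hy : ∀ n s t, y n (s, t) ∈ J)
    (hy0 : ∀ n, Tendsto (fun t => y n (0, t)) atTop (𝓝 0)) :
    ∃ Φ : ℝ → (unitInterval × ℝ →ᵇ N) →ₗ[ℂ] N,
      (∀ t, 1 ≤ t → ∀ x, ‖Φ t x‖ ≤ ‖x‖) ∧ (∀ t x, Φ t (star x) = star (Φ t x)) ∧
      (∀ x, ContinuousOn (fun t => Φ t x) (Set.Ici 1)) ∧
      (∀ t, 1 ≤ t → ∀ x, Φ t x - x (1, t) ∈ J) ∧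
      (∀ n, Tendsto (fun t => Φ t (y n)) atTop (𝓝 0)) ∧
      ∀ n x, Tendsto (fun t => Φ t (x * z n) - Φ t x * Φ t (z n)) atTop (𝓝 0) := by
  set T : ℕ → Set ℝ := fun n => Set.Icc (n : ℝ) (n + 1) with hT
  set L : ℕ → Set N := fun n => ⋃ j ∈ Set.Iic n, z j '' (Set.univ ×ˢ T n) with hL
  set D : ℕ → Set N := fun n => (⋃ j ∈ Set.Iic n, y j '' (Set.univ ×ˢ T n)) ∪
    ⋃ j ∈ Set.Iic n, (fun p : (unitInterval × unitInterval) × ℝ =>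
      z j (p.1.1, p.2) - z j (p.1.2, p.2)) '' (Set.univ ×ˢ T n) with hD
  have hLc : ∀ n, IsCompact (L n) := fun n =>
    (Set.finite_Iic n).isCompact_biUnion fun j _ =>
      (isCompact_univ.prod isCompact_Icc).image (z j).continuous
  have hDc : ∀ n, IsCompact (D n) := fun n =>
    ((Set.finite_Iic n).isCompact_biUnion fun j _ =>
      (isCompact_univ.prod isCompact_Icc).image (y j).continuous).union
    ((Set.finite_Iic n).isCompact_biUnion fun j _ =>
      (isCompact_univ.prod isCompact_Icc).image (by fun_prop))
  -- At time `t` with floor `n` there are at most `n + 8` tents, and the product estimate multiplies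
  -- the commutator error by the square of their number; the cube still leaves a null sequence.
  set ε : ℕ → ℝ := fun n => 1 / ((n : ℝ) + 8) ^ 3 with hε
  have hε0 : ∀ n, 0 < ε n := fun n => by positivity
  obtain ⟨w, hw, hgood⟩ := exists_quasicentral_path hJ hLc hDc (ρ := fun n => (n : ℝ) + 5) (ε := ε)
    (fun n => by positivity) hε0 (fun n => n + 8)
  have hfloor : ∀ t : ℝ, 1 ≤ t → (⌊t⌋₊ : ℝ) ≤ t ∧ t ≤ ⌊t⌋₊ + 1 ∧ ⌈t⌉₊ + 7 ≤ ⌊t⌋₊ + 8 := fun t ht =>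
    ⟨Nat.floor_le (by linarith), (Nat.lt_floor_add_one t).le, by
      have := Nat.ceil_le_floor_add_one t; omega⟩
  have hinv : Tendsto (fun t : ℝ => 1 / ((⌊t⌋₊ : ℝ) + 8)) atTop (𝓝 0) := by
    have h1 : Tendsto (fun n : ℕ => 1 / ((n : ℝ) + 8)) atTop (𝓝 0) :=
      (tendsto_const_nhds.div_atTop
        (tendsto_natCast_atTop_atTop.atTop_add tendsto_const_nhds))
    exact h1.comp tendsto_nat_floor_atTop
  have hεle : ∀ n : ℕ, ((n : ℝ) + 8) * (((n : ℝ) + 8) * ε n) = 1 / ((n : ℝ) + 8) := fun n => by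
    simp only [hε]
    field_simp
  have hεle1 : ∀ n : ℕ, ((n : ℝ) + 8) * ε n ≤ 1 / ((n : ℝ) + 8) := fun n => by
    rw [← hεle]
    have : (0 : ℝ) ≤ n := by positivity
    have h3 : 0 ≤ ((n : ℝ) + 8) * ε n := mul_nonneg (by positivity) (hε0 n).le
    nlinarith
  have hεle2 : ∀ n : ℕ, ε n ≤ 1 / ((n : ℝ) + 8) := fun n => by
    refine le_trans ?_ (hεle1 n)
    have : (0 : ℝ) ≤ n := by positivity
    nlinarith [hε0 n]
  refine ⟨fun t => asymptoticCompression w t, fun t ht x => norm_asymptoticCompression_le hw ht x,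
    fun t x => asymptoticCompression_star w t x, fun x => continuousOn_asymptoticCompression hw x,
    fun t ht x => asymptoticCompression_sub_mem hw hJc ht x, fun j => ?_, fun j x => ?_⟩
  · refine squeeze_zero_norm' (a := fun t => 2 * ‖y j (0, t)‖ + 1 / ((⌊t⌋₊ : ℝ) + 8)) ?_ ?_
    · filter_upwards [eventually_ge_atTop 1, tendsto_nat_floor_atTop.eventually_ge_atTop j]
        with t ht htj
      obtain ⟨hf1, hf2, hf3⟩ := hfloor t ht
      refine (norm_asymptoticCompression_le_of_ideal ht (hε0 ⌊t⌋₊).le fun i hi => ?_).trans ?_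
      · have h := ((hgood ⌊t⌋₊ t hf1 (t + 4) ⟨by linarith, by linarith⟩).2 i hi
          (y j (nodePos t i, t)) (Or.inl (Set.mem_biUnion (Set.mem_Iic.2 htj)
            ⟨(nodePos t i, t), ⟨trivial, hf1, hf2⟩, rfl⟩))).1
        rwa [Ideal.Quotient.eq_zero_iff_mem.2 (hy j _ _), norm_zero, zero_add] at h
      · refine add_le_add le_rfl (le_trans ?_ (hεle1 _))
        refine mul_le_mul_of_nonneg_right ?_ (hε0 _).le
        exact_mod_cast hf3
    · simpa using ((hy0 j).norm.const_mul 2).add hinv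
  · rw [NormedAddGroup.tendsto_nhds_zero]
    intro c hc
    set η := c / (8 * (‖x‖ + 1)) with hη
    have hη0 : 0 < η := by positivity
    -- Modulo `J` the value `z j (s, t)` does not depend on `t`, so one modulus of continuity in `s`
    -- serves all times.
    have hqc : Continuous fun s : unitInterval => Ideal.Quotient.mk J (z j (s, 1)) :=
      continuous_quot_mk.comp ((z j).continuous.comp (by fun_prop))
    obtain ⟨δ, hδ0, hδ⟩ := Metric.uniformContinuous_iff.1
      (CompactSpace.uniformContinuous_of_continuous hqc) η hη0
    have hstep : Tendsto (fun t : ℝ => 3 / (t + 4)) atTop (𝓝 0) :=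
      tendsto_const_nhds.div_atTop (tendsto_id.atTop_add tendsto_const_nhds)
    have herr : Tendsto (fun t : ℝ => 5 * ‖x‖ * (1 / ((⌊t⌋₊ : ℝ) + 8))) atTop (𝓝 0) := by
      simpa using hinv.const_mul (5 * ‖x‖)
    filter_upwards [eventually_ge_atTop 1, tendsto_nat_floor_atTop.eventually_ge_atTop j,
      hstep.eventually (gt_mem_nhds hδ0), herr.eventually (gt_mem_nhds (half_pos hc))]
      with t ht htj hst her
    obtain ⟨hf1, hf2, hf3⟩ := hfloor t ht
    obtain ⟨h0, h1, -⟩ := hw t (by linarith)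
    obtain ⟨h0', h1'⟩ := scaled_nonneg_le (r := t + 4) (by linarith) h0 h1
    have hg := hgood ⌊t⌋₊ t hf1 (t + 4) ⟨by linarith, by linarith⟩
    have hn : t + 4 + 2 ≤ ((⌈t⌉₊ + 7 : ℕ) : ℝ) := by
      have := Nat.le_ceil t
      push_cast
      linarith
    have key := norm_compress_mul_sub_le h0' h1' hn (z := fun i => x (nodePos t i, t))
      (z' := fun i => z j (nodePos t i, t)) (M := ‖x‖) (a := η + ε ⌊t⌋₊) (b := ε ⌊t⌋₊)
      (norm_nonneg _) (by have := hε0 ⌊t⌋₊; positivity) (fun i _ => x.norm_coe_le_norm _)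
      (fun i hi l hl => hg.1 i (by omega) _ (Set.mem_biUnion (Set.mem_Iic.2 htj)
            ⟨(nodePos t l, t), ⟨trivial, hf1, hf2⟩, rfl⟩))
      (fun i hi l hl hil hli => by
        -- Tents below `2` give no control by the quotient norm, but there the two neighbouring
        -- nodes are both `0` and the difference vanishes exactly.
        rcases Nat.lt_or_ge l 2 with h | h
        · rw [nodePos_eq_zero ht (by omega : i ≤ 2), nodePos_eq_zero ht h.le, sub_self, zero_mul,
            norm_zero]
          have := hε0 ⌊t⌋₊
          positivity
        · refine ((hg.2 l h _ (Or.inr (Set.mem_biUnion (Set.mem_Iic.2 htj)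
            ⟨((nodePos t i, nodePos t l), t), ⟨trivial, hf1, hf2⟩, rfl⟩))).2).trans
            (add_le_add ?_ le_rfl)
          have e : ∀ s, Ideal.Quotient.mk J (z j (s, t)) = Ideal.Quotient.mk J (z j (s, 1)) :=
            fun s => (Ideal.Quotient.mk_eq_mk_iff_sub_mem _ _).2 (hz j s t)
          have := hδ ((dist_nodePos_le ht hil hli).trans_lt hst)
          rw [map_sub, e, e, ← dist_eq_norm]
          exact this.le)
    have hx : (0 : ℝ) ≤ ‖x‖ := norm_nonneg x
    have hN : ((⌈t⌉₊ + 7 : ℕ) : ℝ) ≤ (⌊t⌋₊ : ℝ) + 8 := by exact_mod_cast hf3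
    have hb : ((⌈t⌉₊ + 7 : ℕ) : ℝ) * (‖x‖ * (((⌈t⌉₊ + 7 : ℕ) : ℝ) * (2 * ε ⌊t⌋₊))) ≤
        2 * ‖x‖ * (1 / ((⌊t⌋₊ : ℝ) + 8)) := by
      rw [← hεle]
      calc _ ≤ ((⌊t⌋₊ : ℝ) + 8) * (‖x‖ * (((⌊t⌋₊ : ℝ) + 8) * (2 * ε ⌊t⌋₊))) := by
            have := (hε0 ⌊t⌋₊).le
            gcongr
        _ = _ := by ring
    have hη' : ‖x‖ * (3 * η) ≤ 3 * c / 8 := by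
      rw [hη, show ‖x‖ * (3 * (c / (8 * (‖x‖ + 1)))) = 3 * c / 8 * (‖x‖ / (‖x‖ + 1)) by field_simp]
      exact mul_le_of_le_one_right (by positivity) ((div_le_one (by positivity)).2 (by linarith))
    have h5 : ‖x‖ * (3 * ε ⌊t⌋₊) ≤ 3 * ‖x‖ * (1 / ((⌊t⌋₊ : ℝ) + 8)) := by
      have := mul_le_mul_of_nonneg_left (hεle2 ⌊t⌋₊) hx
      linarith
    refine lt_of_le_of_lt key ?_
    rw [mul_add 3, mul_add]
    linarith

end AsymptoticCompression

/-! ### Continuous selections for surjections of Banach spaces. -/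

section Selection

variable {E F : Type*} [NormedAddCommGroup E] [NormedSpace ℝ E] [NormedAddCommGroup F]
  [NormedSpace ℝ F]

/-- A bounded preimage of `y p` remains an approximate preimage near `p`, and the conditions are
convex, so a partition of unity glues. The bound `C * r` makes the successive corrections summable.
-/
theorem exists_approximate_section [CompleteSpace E] [CompleteSpace F] (f : E →L[ℝ] F)
    (hf : Function.Surjective f) :
    ∃ C > 0, ∀ {X : Type _} [TopologicalSpace X] [NormalSpace X] [ParacompactSpace X] (y : C(X, F))
      (r : ℝ) (_ : ∀ p, ‖y p‖ ≤ r) (ε : ℝ) (_ : 0 < ε),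
      ∃ x : C(X, E), ∀ p, ‖x p‖ ≤ C * r ∧ ‖y p - f (x p)‖ ≤ ε := by
  obtain ⟨C, hC, h⟩ := f.exists_preimage_norm_le hf
  refine ⟨C, hC, fun {X} _ _ _ y r hr ε hε => ?_⟩
  refine exists_continuous_forall_mem_convex_of_local_const
    (t := fun p => {v | ‖v‖ ≤ C * r ∧ ‖y p - f v‖ ≤ ε}) (fun p => ?_) fun p => ?_
  · have e : {v : E | ‖v‖ ≤ C * r ∧ ‖y p - f v‖ ≤ ε} =
        Metric.closedBall 0 (C * r) ∩ f.toLinearMap ⁻¹' Metric.closedBall (y p) ε := by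
      ext v
      simp [dist_eq_norm, norm_sub_rev]
    rw [e]
    exact (convex_closedBall _ _).inter ((convex_closedBall _ _).linear_preimage _)
  · obtain ⟨v, hv, hvn⟩ := h (y p)
    refine ⟨v, ?_⟩
    have hc : Tendsto (fun p' => ‖y p' - f v‖) (𝓝 p) (𝓝 0) := by
      have := ((y.continuous.tendsto p).sub_const (f v)).norm
      simpa [hv] using this
    filter_upwards [hc.eventually (ge_mem_nhds hε)] with p' hp'
    exact ⟨hvn.trans (mul_le_mul_of_nonneg_left (hr p) hC.le), hp'⟩

/-- The Bartle–Graves theorem: a continuous linear surjection of Banach spaces has a continuous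
right inverse. -/
theorem exists_continuous_rightInverse [CompleteSpace E] [CompleteSpace F] (f : E →L[ℝ] F)
    (hf : Function.Surjective f) : ∃ g : C(F, E), ∀ y, f (g y) = y := by
  obtain ⟨C, hC, hstep⟩ := exists_approximate_section f hf
  obtain ⟨s₀, hs₀⟩ : ∃ s : C(F, E), ∀ p, ‖p - f (s p)‖ ≤ (1 / 2 : ℝ) ^ 0 := by
    refine exists_continuous_forall_mem_convex_of_local_const
      (t := fun p => {v | ‖p - f v‖ ≤ (1 / 2 : ℝ) ^ 0}) (fun p => ?_) fun p => ?_
    · have e : {v : E | ‖p - f v‖ ≤ (1 / 2 : ℝ) ^ 0} =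
          f.toLinearMap ⁻¹' Metric.closedBall p ((1 / 2 : ℝ) ^ 0) := by
        ext v
        simp [dist_eq_norm, norm_sub_rev]
      rw [e]
      exact (convex_closedBall _ _).linear_preimage _
    · obtain ⟨v, rfl⟩ := hf p
      refine ⟨v, ?_⟩
      filter_upwards [Metric.closedBall_mem_nhds (f v) (show (0 : ℝ) < (1 / 2) ^ 0 by norm_num)]
        with p' hp'
      simpa [dist_eq_norm] using hp'
  -- Each step approximately lifts the residual of the last: the residual halves while the
  -- correction has size at most `C / 2 ^ n`, so the sections converge uniformly.
  have hnext : ∀ (n : ℕ) (s : {s : C(F, E) // ∀ p, ‖p - f (s p)‖ ≤ (1 / 2 : ℝ) ^ n}),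
      ∃ s' : {s : C(F, E) // ∀ p, ‖p - f (s p)‖ ≤ (1 / 2 : ℝ) ^ (n + 1)},
        ∀ p, dist (s.1 p) (s'.1 p) ≤ C * (1 / 2 : ℝ) ^ n := by
    rintro n ⟨s, hs⟩
    obtain ⟨x, hx⟩ := hstep (X := F) ⟨fun p => p - f (s p), by fun_prop⟩ _ hs
      ((1 / 2) ^ (n + 1)) (by positivity)
    refine ⟨⟨s + x, fun p => ?_⟩, fun p => ?_⟩
    · have := (hx p).2
      simp only [ContinuousMap.coe_mk] at this
      rwa [ContinuousMap.add_apply, map_add, ← sub_sub]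
    · rw [dist_comm, dist_eq_norm]
      simpa using (hx p).1
  choose next hnext using hnext
  let S : ∀ n, {s : C(F, E) // ∀ p, ‖p - f (s p)‖ ≤ (1 / 2 : ℝ) ^ n} :=
    fun n => Nat.rec ⟨s₀, hs₀⟩ (fun n s => next n s) n
  have hS : ∀ n p, dist ((S n).1 p) ((S (n + 1)).1 p) ≤ C * (1 / 2 : ℝ) ^ n :=
    fun n p => hnext n (S n) p
  choose g hg using fun p => cauchySeq_tendsto_of_complete
    (cauchySeq_of_le_geometric (1 / 2 : ℝ) C (by norm_num) (fun n => hS n p))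
  have hd : ∀ n p, dist ((S n).1 p) (g p) ≤ C * (1 / 2 : ℝ) ^ n / (1 - 1 / 2) := fun n p =>
    dist_le_of_le_geometric_of_tendsto (1 / 2 : ℝ) C (by norm_num) (fun n => hS n p) (hg p) n
  have hpow : Tendsto (fun n : ℕ => (1 / 2 : ℝ) ^ n) atTop (𝓝 0) :=
    tendsto_pow_atTop_nhds_zero_of_lt_one (by norm_num) (by norm_num)
  have hlim : Tendsto (fun n : ℕ => C * (1 / 2 : ℝ) ^ n / (1 - 1 / 2)) atTop (𝓝 0) := by
    simpa using (hpow.const_mul C).div_const (1 - 1 / 2)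
  have hu : TendstoUniformly (fun n p => (S n).1 p) g atTop := by
    rw [Metric.tendstoUniformly_iff]
    intro ε hε
    filter_upwards [hlim.eventually (gt_mem_nhds hε)] with n hn p
    rw [dist_comm]
    exact (hd n p).trans_lt hn
  refine ⟨⟨g, hu.continuous (Frequently.of_forall fun n => (S n).1.continuous)⟩, fun y => ?_⟩
  have h1 : Tendsto (fun n => ‖y - f ((S n).1 y)‖) atTop (𝓝 ‖y - f (g y)‖) :=
    (((f.continuous.tendsto _).comp (hg y)).const_sub y).norm
  have h2 : Tendsto (fun n => ‖y - f ((S n).1 y)‖) atTop (𝓝 0) :=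
    squeeze_zero (fun _ => norm_nonneg _) (fun n => (S n).2 y) hpow
  have := tendsto_nhds_unique h1 h2
  exact (sub_eq_zero.1 (norm_eq_zero.1 this)).symm

end Selection

/-! ### An algebraic relation that forces contractivity. -/

section Contractivity

/-- The element is `b = 1 - √(1 - a* a)`, given by a function vanishing at `0` and hence available
without a unit. The relation says `(1 - b)² + a* a = 1`; being algebraic, it survives homomorphisms
and, approximately, asymptotic homomorphisms. -/
theorem exists_add_self_eq {D : Type*} [NonUnitalCStarAlgebra D] {a : D} (ha : ‖a‖ ≤ 1) :
    ∃ b : D, IsSelfAdjoint b ∧ b + b = b * b + star a * a := by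
  let _ : PartialOrder D := CStarAlgebra.spectralOrder D
  have _ : StarOrderedRing D := CStarAlgebra.spectralOrderedRing D
  set h := star a * a with hh
  have hsa : IsSelfAdjoint h := IsSelfAdjoint.star_mul_self a
  have hspec : ∀ x ∈ quasispectrum ℝ h, 0 ≤ x ∧ x ≤ 1 := fun x hx => by
    refine ⟨quasispectrum_nonneg_of_nonneg h (star_mul_self_nonneg a) x hx, ?_⟩
    refine (le_abs_self x).trans
      ((NonUnitalIsometricContinuousFunctionalCalculus.norm_quasispectrum_le h hx
      hsa).trans ?_)
    rw [hh, CStarRing.norm_star_mul_self]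
    nlinarith [norm_nonneg a]
  set f : ℝ → ℝ := fun x => 1 - √(1 - x) with hf
  have hfc : Continuous f := by fun_prop
  have hf0 : f 0 = 0 := by simp [hf]
  refine ⟨cfcₙ f h, cfcₙ_predicate f h, ?_⟩
  suffices e : cfcₙ f h + cfcₙ f h = cfcₙ f h * cfcₙ f h + cfcₙ (fun x : ℝ => x) h by
    rwa [cfcₙ_id' ℝ h] at e
  rw [← cfcₙ_add f f h, ← cfcₙ_mul f f h, ← cfcₙ_add (fun x => f x * f x) (fun x => x) h
    (by fun_prop) (by simp [hf0])]
  refine cfcₙ_congr fun x hx => ?_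
  have := Real.mul_self_sqrt (show 0 ≤ 1 - x by linarith [(hspec x hx).2])
  simp only [hf]
  nlinarith

variable {N : Type*} [CStarAlgebra N] [PartialOrder N] [StarOrderedRing N]

theorem norm_mul_self_le_of_sum (m p c : N) :
    ‖m * c‖ * ‖m * c‖ ≤ ‖star c * (star p * p + star m * m) * c‖ := by
  rw [← CStarRing.norm_star_mul_self]
  refine CStarAlgebra.norm_le_norm_of_nonneg_of_le (star_mul_self_nonneg _) ?_
  have e : star c * (star p * p + star m * m) * c =
      star (p * c) * (p * c) + star (m * c) * (m * c) := by
    simp only [star_mul]; noncomm_ring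
  rw [e]
  exact le_add_of_nonneg_left (star_mul_self_nonneg _)

/-- Multiplying `m` by `1 - u`, with `u` from the approximate unit, keeps its class and makes the
error in `p* p + m* m = 1` small, so `‖m * (1 - u)‖ ^ 2 ≤ 1 + ε`. -/
theorem norm_mk_le_one_of_sum {J : Ideal N} [J.IsTwoSided] (hJ : HasIncreasingApproxUnit J)
    {m p : N} (h : star p * p + star m * m - 1 ∈ J) : ‖Ideal.Quotient.mk J m‖ ≤ 1 := by
  obtain ⟨U, hUJ, hU, happ⟩ := hJ
  have key : ∀ ε : ℝ, 0 < ε → ‖Ideal.Quotient.mk J m‖ * ‖Ideal.Quotient.mk J m‖ ≤ 1 + ε := by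
    intro ε hε
    set j := star p * p + star m * m - 1 with hj
    obtain ⟨u, hu, -, huj⟩ := happ ∅ {j} (by simp) (by simpa using h) ε hε
    have huj := huj j (by simp)
    obtain ⟨hu0, hu1⟩ := hU u hu
    have hc : ‖1 - u‖ ≤ 1 := norm_le_one_of_le_one (sub_nonneg.2 hu1) (sub_le_self _ hu0)
    have hq : Ideal.Quotient.mk J m = Ideal.Quotient.mk J (m * (1 - u)) := by
      rw [Ideal.Quotient.mk_eq_mk_iff_sub_mem, mul_sub, mul_one, sub_sub_cancel]
      exact J.mul_mem_left _ (hUJ hu)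
    have hle : ‖Ideal.Quotient.mk J m‖ ≤ ‖m * (1 - u)‖ := by
      rw [hq]
      exact Submodule.Quotient.norm_mk_le J _
    refine (mul_self_le_mul_self (norm_nonneg _) hle).trans
      ((norm_mul_self_le_of_sum m p (1 - u)).trans ?_)
    have e : star (1 - u) * (star p * p + star m * m) * (1 - u) =
        (1 - u) * (1 - u) + (1 - u) * j * (1 - u) := by
      rw [star_sub, star_one, hu0.isSelfAdjoint.star_eq, hj]; noncomm_ring
    rw [e]
    refine (norm_add_le _ _).trans (add_le_add ?_ ?_)
    · exact (norm_mul_le _ _).trans (mul_le_one₀ hc (norm_nonneg _) hc)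
    · exact (norm_mul_le _ _).trans ((mul_le_of_le_one_right (norm_nonneg _) hc).trans huj)
  have h1 := le_of_forall_pos_le_add key
  nlinarith [norm_nonneg (Ideal.Quotient.mk J m)]

end Contractivity

/-! ### Norm bounds for extensions and asymptotic homomorphisms. -/

section Bounds

variable {D B : Type*} [NonUnitalCStarAlgebra D] [NonUnitalCStarAlgebra B]

theorem q_surjective : Function.Surjective (q B) := Ideal.Quotient.mk_surjective

theorem q_eq_zero_iff {m : 𝓜(ℂ, B)} : q B m = 0 ↔ m ∈ baseIdeal B :=
  Ideal.Quotient.eq_zero_iff_mem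

theorem continuous_q : Continuous (q B) := continuous_quot_mk

theorem Extension.norm_apply_le_one (φ : Extension D B) {a : D} (ha : ‖a‖ ≤ 1) : ‖φ a‖ ≤ 1 := by
  let _ : PartialOrder 𝓜(ℂ, B) := CStarAlgebra.spectralOrder _
  have _ : StarOrderedRing 𝓜(ℂ, B) := CStarAlgebra.spectralOrderedRing _
  obtain ⟨b, hb, hbb⟩ := exists_add_self_eq ha
  obtain ⟨m, hm⟩ := q_surjective (φ a)
  obtain ⟨x, hx⟩ := q_surjective (φ b)
  rw [← hm]
  refine norm_mk_le_one_of_sum (hasIncreasingApproxUnit_baseIdeal B) (p := 1 - x) ?_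
  rw [← q_eq_zero_iff]
  simp only [map_sub, map_add, map_mul, map_one, star_sub, star_one, q_star, hm, hx]
  rw [← map_star, ← map_star, hb.star_eq]
  have := congrArg φ hbb
  simp only [map_add, map_mul] at this
  have e : (1 - φ b) * (1 - φ b) + φ (star a) * φ a - 1 =
      φ b * φ b + φ (star a) * φ a - (φ b + φ b) := by noncomm_ring
  rw [e, this, sub_self]

theorem Extension.norm_apply_le (φ : Extension D B) (a : D) : ‖φ a‖ ≤ ‖a‖ := by
  rcases eq_or_ne a 0 with rfl | ha
  · simp
  have ha' : ‖a‖ ≠ 0 := norm_ne_zero_iff.2 ha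
  have h1 : ‖((‖a‖ : ℂ)⁻¹ • a)‖ ≤ 1 := by
    rw [norm_smul, norm_inv, Complex.norm_real, norm_norm, inv_mul_cancel₀ ha']
  have h2 := φ.norm_apply_le_one h1
  rw [map_smul, norm_smul, norm_inv, Complex.norm_real, norm_norm, inv_mul_le_iff₀ (by positivity),
    mul_one] at h2
  exact h2

theorem Extension.continuous (φ : Extension D B) : Continuous φ :=
  AddMonoidHomClass.continuous_of_bound φ 1 fun a => by simpa using φ.norm_apply_le a

variable {l : ℝ → D → 𝓜(ℂ, B)}

theorem IsAsymptoticHom.tendsto_zero (hl : IsAsymptoticHom l) :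
    Tendsto (fun t => l t 0) atTop (𝓝 0) := by
  have := hl.add_smul 0 0 1
  simpa using this.neg

theorem IsAsymptoticHom.tendsto_smul (hl : IsAsymptoticHom l) (a : D) (c : ℂ) :
    Tendsto (fun t => l t (c • a) - c • l t a) atTop (𝓝 0) := by
  have := (hl.add_smul 0 a c).add hl.tendsto_zero
  simp only [zero_add, add_zero] at this
  refine this.congr fun t => ?_
  abel

theorem IsAsymptoticHom.tendsto_sub (hl : IsAsymptoticHom l) (a b : D) :
    Tendsto (fun t => l t (a - b) - (l t a - l t b)) atTop (𝓝 0) := by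
  refine (hl.add_smul a b (-1)).congr fun t => ?_
  rw [neg_one_smul, neg_one_smul, ← sub_eq_add_neg, ← sub_eq_add_neg]

/-- For large `t` the relation `(1 - b)² + a* a = 1` holds for the images up to an error that grows
only linearly in `‖l t a‖` and `‖1 - l t b‖`, while the squares of both norms are bounded by the
left side. The quadratic growth absorbs the error without any bound known beforehand. -/
theorem IsAsymptoticHom.eventually_norm_le_of_norm_le_one (hl : IsAsymptoticHom l) {a : D}
    (ha : ‖a‖ ≤ 1) : ∀ᶠ t in atTop, ‖l t a‖ ≤ 3 / 2 := by
  let _ : PartialOrder 𝓜(ℂ, B) := CStarAlgebra.spectralOrder _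
  have _ : StarOrderedRing 𝓜(ℂ, B) := CStarAlgebra.spectralOrderedRing _
  obtain ⟨b, hb, hbb⟩ := exists_add_self_eq ha
  have small : ∀ {f : ℝ → 𝓜(ℂ, B)}, Tendsto f atTop (𝓝 0) → ∀ᶠ t in atTop, ‖f t‖ ≤ 1 / 32 :=
    fun hf => hf.norm.eventually (ge_mem_nhds (by rw [norm_zero]; norm_num))
  filter_upwards [small (hl.add_smul b b 1), small (hl.add_smul (b * b) (Star.star a * a) 1),
    small (hl.mul b b), small (hl.mul (Star.star a) a), small (hl.star a), small (hl.star b)]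
    with t h1 h2 h3 h4 h5 h6
  rw [one_smul, one_smul] at h1 h2
  rw [hb.star_eq] at h6
  rw [hbb] at h1
  set e1 := l t (b * b + Star.star a * a) - (l t b + l t b) with he1
  set e2 := l t (b * b + Star.star a * a) - (l t (b * b) + l t (Star.star a * a)) with he2
  set e3 := l t (b * b) - l t b * l t b with he3
  set e4 := l t (Star.star a * a) - l t (Star.star a) * l t a with he4
  set e5 := l t (Star.star a) - Star.star (l t a) with he5
  set e6 := l t b - Star.star (l t b) with he6
  set S := Star.star (1 - l t b) * (1 - l t b) + Star.star (l t a) * l t a with hS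
  have hSe : S = 1 + (e6 + (e1 - e2 - e3 - e4) - e6 * l t b - e5 * l t a) := by
    rw [hS, he1, he2, he3, he4, he5, he6, star_sub, star_one]
    noncomm_ring
  have hone : ‖(1 : 𝓜(ℂ, B))‖ ≤ 1 := norm_le_one_of_le_one zero_le_one le_rfl
  have hb1 : ‖l t b‖ ≤ 1 + ‖1 - l t b‖ := by
    have := norm_sub_le (1 : 𝓜(ℂ, B)) (1 - l t b)
    rw [sub_sub_cancel] at this
    linarith
  have hSn : ‖S‖ ≤ 1 + 5 / 32 + 1 / 32 * ‖l t b‖ + 1 / 32 * ‖l t a‖ := by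
    have m1 : ‖e6 * l t b‖ ≤ 1 / 32 * ‖l t b‖ := (norm_mul_le _ _).trans (by gcongr)
    have m2 : ‖e5 * l t a‖ ≤ 1 / 32 * ‖l t a‖ := (norm_mul_le _ _).trans (by gcongr)
    rw [hSe]
    have n1 := norm_add_le 1 (e6 + (e1 - e2 - e3 - e4) - e6 * l t b - e5 * l t a)
    have n2 := norm_sub_le (e6 + (e1 - e2 - e3 - e4) - e6 * l t b) (e5 * l t a)
    have n3 := norm_sub_le (e6 + (e1 - e2 - e3 - e4)) (e6 * l t b)
    have n4 := norm_add_le e6 (e1 - e2 - e3 - e4)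
    have n5 := norm_sub_le (e1 - e2 - e3) e4
    have n6 := norm_sub_le (e1 - e2) e3
    have n7 := norm_sub_le e1 e2
    linarith
  have hm := norm_mul_self_le_of_sum (l t a) (1 - l t b) 1
  have hp := norm_mul_self_le_of_sum (1 - l t b) (l t a) 1
  rw [add_comm] at hp
  rw [mul_one, mul_one, star_one, one_mul, ← hS] at hm hp
  set m := ‖l t a‖
  set p := ‖1 - l t b‖
  -- The two quadratic inequalities are added to bound `m + p` before bounding `m` alone.
  have hsum : m + p ≤ 4 := by nlinarith [sq_nonneg (m - p), sq_nonneg (m + p - 4)]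
  nlinarith [norm_nonneg (l t a)]

theorem IsAsymptoticHom.eventually_norm_le (hl : IsAsymptoticHom l) {a : D} {r : ℝ}
    (hr : ‖a‖ < r) : ∀ᶠ t in atTop, ‖l t a‖ ≤ 2 * r := by
  have hr0 : 0 < r := (norm_nonneg a).trans_lt hr
  have hrc : (r : ℂ) ≠ 0 := by exact_mod_cast hr0.ne'
  have h1 : ‖(r : ℂ)⁻¹ • a‖ ≤ 1 := by
    rw [norm_smul, norm_inv, Complex.norm_real, Real.norm_of_nonneg hr0.le,
      inv_mul_le_iff₀ hr0, mul_one]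
    exact hr.le
  have h2 := (hl.tendsto_smul ((r : ℂ)⁻¹ • a) r).norm.eventually
    (ge_mem_nhds (show ‖(0 : 𝓜(ℂ, B))‖ < r / 2 by rw [norm_zero]; positivity))
  filter_upwards [h2, hl.eventually_norm_le_of_norm_le_one h1] with t ht1 ht2
  rw [smul_inv_smul₀ hrc] at ht1
  have := norm_sub_norm_le (l t a) ((r : ℂ) • l t ((r : ℂ)⁻¹ • a))
  rw [norm_smul, Complex.norm_real, Real.norm_of_nonneg hr0.le] at this
  nlinarith

theorem IsAsymptoticHom.exists_norm_le (hl : IsAsymptoticHom l) (a : D) :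
    ∃ C, ∀ t, 1 ≤ t → ‖l t a‖ ≤ C := by
  obtain ⟨T, hT⟩ := eventually_atTop.1 (hl.eventually_norm_le (lt_add_one ‖a‖))
  obtain ⟨C, hC⟩ := (isCompact_Icc (a := (1 : ℝ)) (b := T)).exists_bound_of_continuousOn
    ((hl.continuousOn a).mono Set.Icc_subset_Ici_self)
  refine ⟨max C (2 * (‖a‖ + 1)), fun t ht => ?_⟩
  rcases le_total t T with h | h
  · exact (hC t ⟨ht, h⟩).trans (le_max_left _ _)
  · exact (hT t h).trans (le_max_right _ _)

end Bounds

/-! ### Homotopy invariance of asymptotic splitting. -/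

section HomotopyInvariance

variable {D B : Type*} [NonUnitalCStarAlgebra D] [NonUnitalCStarAlgebra B]

instance : IsClosed (baseIdeal B : Set 𝓜(ℂ, B)) := isClosed_baseIdeal B

instance : T2Space (Corona B) := by
  let _ := (Submodule.Quotient.normedAddCommGroup (baseIdeal B)).toMetricSpace
  exact TopologicalSpace.t2Space_of_metrizableSpace

theorem exists_continuous_section_q : ∃ S : C(Corona B, 𝓜(ℂ, B)), ∀ x, q B (S x) = x :=
  exists_continuous_rightInverse
    ({ toFun := q B
       map_add' := map_add (q B)
       map_smul' := fun _ _ => rfl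
       cont := continuous_q } : 𝓜(ℂ, B) →L[ℝ] Corona B) q_surjective

theorem IsAsymptoticHom.tendsto_mul_sub {l : ℝ → D → 𝓜(ℂ, B)} (hl : IsAsymptoticHom l) {a b : D}
    {x y : ℝ → 𝓜(ℂ, B)} (hx : Tendsto (fun t => x t - l t a) atTop (𝓝 0))
    (hy : Tendsto (fun t => y t - l t b) atTop (𝓝 0)) :
    Tendsto (fun t => x t * y t - l t (a * b)) atTop (𝓝 0) := by
  have hb : ∀ c, IsBoundedUnder (· ≤ ·) atTop (norm ∘ fun t => l t c) := fun c =>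
    ⟨_, eventually_map.2 (hl.eventually_norm_le (lt_add_one ‖c‖))⟩
  have h1 : Tendsto (fun t => (x t - l t a) * (y t - l t b)) atTop (𝓝 0) := by
    simpa using hx.mul hy
  have h2 : Tendsto (fun t => (x t - l t a) * l t b) atTop (𝓝 0) :=
    hx.zero_mul_isBoundedUnder_le (hb b)
  have h3 : Tendsto (fun t => l t a * (y t - l t b)) atTop (𝓝 0) :=
    isBoundedUnder_le_mul_tendsto_zero (hb a) hy
  have := ((h1.add h2).add h3).sub (hl.mul a b)
  simp only [add_zero, sub_zero] at this
  refine this.congr fun t => ?_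
  noncomm_ring

variable (h : unitInterval → Extension D B) (l : ℝ → D → 𝓜(ℂ, B))

/-- Bounded lifts of the homotopy `h` that are asymptotic to `l` at the left endpoint. -/
def liftRelation (hl : IsAsymptoticHom l) : Submodule ℂ (D × (unitInterval × ℝ →ᵇ 𝓜(ℂ, B))) where
  carrier := {p | (∀ s t, q B (p.2 (s, t)) = h s p.1) ∧
    Tendsto (fun t => p.2 (0, t) - l t p.1) atTop (𝓝 0)}
  zero_mem' := by
    refine ⟨fun s t => by simp, ?_⟩
    simpa using hl.tendsto_zero.neg
  add_mem' := by
    rintro ⟨a, x⟩ ⟨b, y⟩ ⟨h1, h2⟩ ⟨h3, h4⟩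
    refine ⟨fun s t => ?_, ?_⟩
    · have := h1 s t
      have := h3 s t
      simp_all
    · have := (h2.add h4).sub (hl.add_smul a b 1)
      simp only [add_zero, sub_zero] at this
      refine this.congr fun t => ?_
      simp only [one_smul, Prod.mk_add_mk, BoundedContinuousFunction.add_apply]
      abel
  smul_mem' := by
    rintro c ⟨a, x⟩ ⟨h1, h2⟩
    refine ⟨fun s t => ?_, ?_⟩
    · have := h1 s t
      simp only [Prod.smul_mk, BoundedContinuousFunction.smul_apply, q_smul, map_smul]
      rw [this]
    · have := (h2.const_smul c).sub (hl.tendsto_smul a c)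
      simp only [smul_zero, sub_zero] at this
      refine this.congr fun t => ?_
      simp only [Prod.smul_mk, BoundedContinuousFunction.smul_apply, smul_sub]
      abel

variable {h l}

/-- Individual maps `l t` need not be continuous, but `l t p.1 - l t p'.1` is asymptotic to `l t
(p.1 - p'.1)`, which is eventually at most a multiple of a bound on `‖p.1 - p'.1‖`. Closedness makes
the relation a Banach space, as the selection theorem requires. -/
theorem isClosed_liftRelation (hl : IsAsymptoticHom l) :
    IsClosed (liftRelation h l hl : Set (D × (unitInterval × ℝ →ᵇ 𝓜(ℂ, B)))) := by
  have e : (liftRelation h l hl : Set (D × (unitInterval × ℝ →ᵇ 𝓜(ℂ, B)))) =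
      (⋂ s, ⋂ t, {p | q B (p.2 (s, t)) = h s p.1}) ∩
        {p | Tendsto (fun t => p.2 (0, t) - l t p.1) atTop (𝓝 0)} := by
    ext p
    simp only [Set.mem_inter_iff, Set.mem_iInter, Set.mem_ofPred_eq]
    rfl
  rw [e]
  refine IsClosed.inter (isClosed_iInter fun s => isClosed_iInter fun t => ?_) ?_
  · have h1 : Continuous fun p : D × (unitInterval × ℝ →ᵇ 𝓜(ℂ, B)) => p.2 (s, t) := by fun_prop
    exact isClosed_eq (continuous_q.comp h1) ((h s).continuous.comp continuous_fst)
  · refine isClosed_of_closure_subset fun p hp => ?_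
    rw [Set.mem_ofPred_eq, NormedAddGroup.tendsto_nhds_zero]
    intro ε hε
    obtain ⟨p', hp', hd⟩ := Metric.mem_closure_iff.1 hp (ε / 8) (by positivity)
    rw [dist_eq_norm] at hd
    have hd1 : ‖p.1 - p'.1‖ < ε / 8 := (norm_fst_le (p - p')).trans_lt hd
    have hd2 : ‖p.2 - p'.2‖ < ε / 8 := (norm_snd_le (p - p')).trans_lt hd
    have h1 := (NormedAddGroup.tendsto_nhds_zero.1 hp') (ε / 8) (by positivity)
    have h2 := (NormedAddGroup.tendsto_nhds_zero.1 (hl.tendsto_sub p.1 p'.1)) (ε / 8)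
      (by positivity)
    filter_upwards [h1, h2, hl.eventually_norm_le hd1] with t h1 h2 h3
    have h4 : ‖p.2 (0, t) - p'.2 (0, t)‖ ≤ ‖p.2 - p'.2‖ := (p.2 - p'.2).norm_coe_le_norm (0, t)
    have e : p.2 (0, t) - l t p.1 = (p.2 (0, t) - p'.2 (0, t)) + (p'.2 (0, t) - l t p'.1) +
        (l t (p.1 - p'.1) - (l t p.1 - l t p'.1)) - l t (p.1 - p'.1) := by abel
    rw [e]
    have n1 := norm_sub_le ((p.2 (0, t) - p'.2 (0, t)) + (p'.2 (0, t) - l t p'.1) +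
        (l t (p.1 - p'.1) - (l t p.1 - l t p'.1))) (l t (p.1 - p'.1))
    have n2 := norm_add₃_le (a := p.2 (0, t) - p'.2 (0, t)) (b := p'.2 (0, t) - l t p'.1)
      (c := l t (p.1 - p'.1) - (l t p.1 - l t p'.1))
    linarith

theorem exists_mem_liftRelation (hl : IsAsymptoticHom l) (hc : ∀ a, Continuous fun s => h s a)
    (hq : ∀ t, 1 ≤ t → ∀ a, q B (l t a) = h 0 a) (a : D) :
    ∃ z, (a, z) ∈ liftRelation h l hl := by
  obtain ⟨S, hS⟩ := exists_continuous_section_q (B := B)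
  have hx : Continuous fun s => S (h s a) := S.continuous.comp (hc a)
  obtain ⟨C, hC⟩ := hl.exists_norm_le a
  obtain ⟨K, hK⟩ := isCompact_univ.exists_bound_of_continuousOn hx.continuousOn
  have hlc : Continuous fun t : ℝ => l (max 1 t) a :=
    (hl.continuousOn a).comp_continuous (by fun_prop) fun t => Set.mem_Ici.2 (le_max_left 1 t)
  -- Correcting `l t a` by `S (h s a) - S (h 0 a)` moves its class from `h 0 a` to `h s a` and
  -- changes nothing at `s = 0`. The cutoff `max 1 t` avoids times where `l` is not controlled.
  refine ⟨BoundedContinuousFunction.ofNormedAddCommGroup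
    (fun p : unitInterval × ℝ => S (h p.1 a) - S (h 0 a) + l (max 1 p.2) a)
    (((hx.comp continuous_fst).sub continuous_const).add (hlc.comp continuous_snd))
    (K + K + C) fun p => ?_, fun s t => ?_, ?_⟩
  · refine (norm_add_le _ _).trans (add_le_add ((norm_sub_le _ _).trans ?_) ?_)
    · exact add_le_add (hK _ trivial) (hK _ trivial)
    · exact hC _ (le_max_left _ _)
  · simp only [BoundedContinuousFunction.coe_ofNormedAddCommGroup, map_add, map_sub, hS]
    rw [hq _ (le_max_left _ _), sub_add_cancel]
  · refine tendsto_const_nhds.congr' ?_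
    filter_upwards [eventually_ge_atTop 1] with t ht
    simp [max_eq_right ht]

/-- A continuous choice of bounded lifts of the homotopy. -/
theorem exists_continuous_liftRelation (hl : IsAsymptoticHom l)
    (hc : ∀ a, Continuous fun s => h s a) (hq : ∀ t, 1 ≤ t → ∀ a, q B (l t a) = h 0 a) :
    ∃ z : C(D, unitInterval × ℝ →ᵇ 𝓜(ℂ, B)), ∀ a, (a, z a) ∈ liftRelation h l hl := by
  have _ : CompleteSpace (liftRelation h l hl) := (isClosed_liftRelation hl).completeSpace_coe
  -- The Bartle–Graves theorem is applied to the projection of the relation onto `D`.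
  obtain ⟨g, hg⟩ := exists_continuous_rightInverse
    (((ContinuousLinearMap.fst ℂ D (unitInterval × ℝ →ᵇ 𝓜(ℂ, B))).comp
      (liftRelation h l hl).subtypeL).restrictScalars ℝ) (fun a => by
        obtain ⟨z, hz⟩ := exists_mem_liftRelation hl hc hq a
        exact ⟨⟨(a, z), hz⟩, rfl⟩)
  refine ⟨⟨fun a => (g a).1.2, by fun_prop⟩, fun a => ?_⟩
  have h1 : (g a).1.1 = a := hg a
  have h2 := (g a).2
  have e : (a, (g a).1.2) = (g a).1 := Prod.ext h1.symm rfl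
  change (a, (g a).1.2) ∈ _
  rw [e]
  exact h2

theorem isClosed_setOf_tendsto_zero {E F : Type*} [SeminormedAddCommGroup E]
    [SeminormedAddCommGroup F] {Φ : ℝ → E → F} (hsub : ∀ t x y, Φ t (x - y) = Φ t x - Φ t y)
    {T C : ℝ} (hC : 0 ≤ C) (hΦ : ∀ t, T ≤ t → ∀ x, ‖Φ t x‖ ≤ C * ‖x‖) :
    IsClosed {x | Tendsto (fun t => Φ t x) atTop (𝓝 0)} := by
  refine isClosed_of_closure_subset fun x hx => ?_
  rw [Set.mem_ofPred_eq, NormedAddGroup.tendsto_nhds_zero]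
  intro ε hε
  obtain ⟨y, hy, hd⟩ := Metric.mem_closure_iff.1 hx (ε / (2 * (C + 1))) (by positivity)
  rw [dist_eq_norm, lt_div_iff₀ (by positivity)] at hd
  have h1 := (NormedAddGroup.tendsto_nhds_zero.1 hy) (ε / 2) (by positivity)
  filter_upwards [h1, eventually_ge_atTop T] with t h1 ht
  have h2 := hΦ t ht (x - y)
  have h3 := norm_add_le (Φ t (x - y)) (Φ t y)
  rw [hsub, sub_add_cancel] at h3
  rw [hsub] at h2
  have := norm_nonneg (x - y)
  linarith

/-- An extension that is strongly homotopic to an asymptotically split one is itself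
asymptotically split. -/
theorem Extension.StronglyHomotopic.isAsymptoticallySplit [TopologicalSpace.SeparableSpace D]
    {φ ψ : Extension D B} (hφψ : φ.StronglyHomotopic ψ) (hφ : φ.IsAsymptoticallySplit) :
    ψ.IsAsymptoticallySplit := by
  let _ : PartialOrder 𝓜(ℂ, B) := CStarAlgebra.spectralOrder _
  have _ : StarOrderedRing 𝓜(ℂ, B) := CStarAlgebra.spectralOrderedRing _
  obtain ⟨h, hc, rfl, rfl⟩ := hφψ
  obtain ⟨l, hl, hq⟩ := hφ
  obtain ⟨z, hz⟩ := exists_continuous_liftRelation hl hc hq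
  have hzq : ∀ a s t, q B (z a (s, t)) = h s a := fun a => (hz a).1
  have hz0 : ∀ a, Tendsto (fun t => z a (0, t) - l t a) atTop (𝓝 0) := fun a => (hz a).2
  -- These are the defects of `z` in multiplication, linearity and adjoints. They take values in the
  -- ideal and tend to zero at `s = 0`. They depend continuously on their parameters, so it suffices
  -- that the contractions `Φ t` kill them asymptotically for a dense sequence.
  let yM : D × D → unitInterval × ℝ →ᵇ 𝓜(ℂ, B) := fun p => z (p.1 * p.2) - z p.1 * z p.2
  let yA : D × D × ℂ → unitInterval × ℝ →ᵇ 𝓜(ℂ, B) := fun p =>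
    z (p.1 + p.2.2 • p.2.1) - (z p.1 + p.2.2 • z p.2.1)
  let yS : D → unitInterval × ℝ →ᵇ 𝓜(ℂ, B) := fun a => z (star a) - star (z a)
  let y : ℕ ⊕ ℕ ⊕ ℕ → unitInterval × ℝ →ᵇ 𝓜(ℂ, B) :=
    Sum.elim (yM ∘ TopologicalSpace.denseSeq _)
      (Sum.elim (yA ∘ TopologicalSpace.denseSeq _) (yS ∘ TopologicalSpace.denseSeq _))
  have hyM : ∀ p, (∀ s t, yM p (s, t) ∈ baseIdeal B) ∧
      Tendsto (fun t => yM p (0, t)) atTop (𝓝 0) := by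
    rintro ⟨a, b⟩
    refine ⟨fun s t => ?_, ?_⟩
    · rw [← q_eq_zero_iff]
      simp [yM, hzq]
    · have := (hz0 (a * b)).sub (hl.tendsto_mul_sub (hz0 a) (hz0 b))
      rw [sub_zero] at this
      refine this.congr fun t => ?_
      simp [yM]
  have hyA : ∀ p, (∀ s t, yA p (s, t) ∈ baseIdeal B) ∧
      Tendsto (fun t => yA p (0, t)) atTop (𝓝 0) := by
    rintro ⟨a, b, c⟩
    refine ⟨fun s t => ?_, ?_⟩
    · rw [← q_eq_zero_iff]
      simp [yA, hzq, q_smul]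
    · have := ((((hz0 (a + c • b)).sub (hz0 a)).sub ((hz0 b).const_smul c))).add (hl.add_smul a b c)
      simp only [sub_zero, smul_zero, add_zero] at this
      refine this.congr fun t => ?_
      simp only [yA, BoundedContinuousFunction.sub_apply, BoundedContinuousFunction.add_apply,
        BoundedContinuousFunction.smul_apply, smul_sub]
      abel
  have hyS : ∀ a, (∀ s t, yS a (s, t) ∈ baseIdeal B) ∧
      Tendsto (fun t => yS a (0, t)) atTop (𝓝 0) := by
    intro a
    refine ⟨fun s t => ?_, ?_⟩
    · rw [← q_eq_zero_iff]
      simp [yS, hzq, q_star, map_star]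
    · have := ((hz0 (star a)).sub (hz0 a).star).add (hl.star a)
      simp only [sub_zero, star_zero, add_zero] at this
      refine this.congr fun t => ?_
      simp only [yS, BoundedContinuousFunction.sub_apply, BoundedContinuousFunction.star_apply,
        star_sub]
      abel
  have hy : ∀ i, (∀ s t, y i (s, t) ∈ baseIdeal B) ∧
      Tendsto (fun t => y i (0, t)) atTop (𝓝 0) := by
    rintro (i | i | i)
    exacts [hyM _, hyA _, hyS _]
  let e := Denumerable.eqv (ℕ ⊕ ℕ ⊕ ℕ)
  obtain ⟨Φ, hΦn, hΦs, hΦc, hΦq, hΦy, hΦm⟩ := exists_asymptotic_compression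
    (isClosed_baseIdeal B) (hasIncreasingApproxUnit_baseIdeal B)
    (z ∘ TopologicalSpace.denseSeq D) (y ∘ e.symm)
    (fun n s t => by rw [← q_eq_zero_iff]; simp [hzq])
    (fun n s t => (hy _).1 s t) (fun n => (hy _).2)
  have hΦy' : ∀ i, Tendsto (fun t => Φ t (y i)) atTop (𝓝 0) := fun i => by
    simpa using hΦy (e i)
  have hcl : IsClosed {x | Tendsto (fun t => Φ t x) atTop (𝓝 0)} :=
    isClosed_setOf_tendsto_zero (T := 1) (fun t => map_sub (Φ t)) zero_le_one
      (by simpa only [one_mul] using hΦn)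
  have hM : ∀ p, Tendsto (fun t => Φ t (yM p)) atTop (𝓝 0) :=
    fun p => (TopologicalSpace.denseRange_denseSeq _).induction_on p
      (hcl.preimage (by fun_prop : Continuous yM)) fun n => hΦy' (Sum.inl n)
  have hA : ∀ p, Tendsto (fun t => Φ t (yA p)) atTop (𝓝 0) :=
    fun p => (TopologicalSpace.denseRange_denseSeq _).induction_on p
      (hcl.preimage (by fun_prop : Continuous yA)) fun n => hΦy' (Sum.inr (Sum.inl n))
  have hS : ∀ p, Tendsto (fun t => Φ t (yS p)) atTop (𝓝 0) :=
    fun p => (TopologicalSpace.denseRange_denseSeq _).induction_on p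
      (hcl.preimage (by fun_prop : Continuous yS)) fun n => hΦy' (Sum.inr (Sum.inr n))
  have hmul : ∀ (x : unitInterval × ℝ →ᵇ 𝓜(ℂ, B)) (b : D),
      Tendsto (fun t => Φ t (x * z b) - Φ t x * Φ t (z b)) atTop (𝓝 0) := by
    intro x b
    have hcl' : IsClosed {x' | Tendsto (fun t => Φ t (x * x') - Φ t x * Φ t x') atTop (𝓝 0)} :=
      isClosed_setOf_tendsto_zero (Φ := fun t x' => Φ t (x * x') - Φ t x * Φ t x') (T := 1)
        (C := 2 * ‖x‖) (fun t u v => by simp only [mul_sub, map_sub]; abel) (by positivity)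
        fun t ht u => by
          have h1 := (hΦn t ht (x * u)).trans (norm_mul_le x u)
          have h2 := (norm_mul_le (Φ t x) (Φ t u)).trans
            (mul_le_mul (hΦn t ht x) (hΦn t ht u) (norm_nonneg _) (norm_nonneg _))
          refine (norm_sub_le _ _).trans ?_
          linarith
    exact (TopologicalSpace.denseRange_denseSeq D).induction_on b
      (hcl'.preimage z.continuous) fun n => hΦm n x
  refine ⟨fun t a => Φ t (z a), ⟨fun a => hΦc _, fun a b c => ?_, fun a b => ?_, fun a => ?_⟩,
    fun t ht a => ?_⟩
  · refine (hA (a, b, c)).congr fun t => ?_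
    simp only [yA, map_sub, map_add, map_smul]
  · have := (hM (a, b)).add (hmul (z a) b)
    rw [add_zero] at this
    refine this.congr fun t => ?_
    simp only [yM, map_sub, sub_add_sub_cancel]
  · refine (hS a).congr fun t => ?_
    simp only [yS, map_sub, hΦs]
  · have := hΦq t ht (z a)
    rw [← q_eq_zero_iff, map_sub, sub_eq_zero] at this
    rw [this, hzq]

end HomotopyInvariance

/-! ### Continuity of the operations of `Q(B)`, by continuous lifting. -/

section CoronaTopology

variable {B : Type*} [NonUnitalCStarAlgebra B]

instance : ContinuousMul (Corona B) where
  continuous_mul := by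
    obtain ⟨S, hS⟩ := exists_continuous_section_q (B := B)
    have h : Continuous fun p : Corona B × Corona B => q B (S p.1 * S p.2) :=
      continuous_q.comp ((S.continuous.comp continuous_fst).mul (S.continuous.comp continuous_snd))
    simpa only [map_mul, hS] using h

instance : ContinuousSMul ℂ (Corona B) where
  continuous_smul := by
    obtain ⟨S, hS⟩ := exists_continuous_section_q (B := B)
    have h : Continuous fun p : ℂ × Corona B => q B (p.1 • S p.2) :=
      continuous_q.comp (continuous_fst.smul (S.continuous.comp continuous_snd))
    simpa only [q_smul, hS] using h

instance : ContinuousAdd (Corona B) where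
  continuous_add := by
    obtain ⟨S, hS⟩ := exists_continuous_section_q (B := B)
    have h : Continuous fun p : Corona B × Corona B => q B (S p.1 + S p.2) :=
      continuous_q.comp ((S.continuous.comp continuous_fst).add (S.continuous.comp continuous_snd))
    simpa only [map_add, hS] using h

end CoronaTopology

/-! ### Formal properties of strong homotopy. -/

section StrongHomotopy

variable {D E B : Type*} [NonUnitalCStarAlgebra D] [NonUnitalCStarAlgebra E]
  [NonUnitalCStarAlgebra B]

/-- The topology of pointwise norm convergence on extensions. -/
@[reducible] def pointTopology : TopologicalSpace (Extension D B) :=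
  TopologicalSpace.induced (fun (φ : Extension D B) (a : D) => φ a) inferInstance

/-- Symmetry and transitivity are thereby inherited from path joinedness. -/
theorem Extension.stronglyHomotopic_iff_joined {φ ψ : Extension D B} :
    φ.StronglyHomotopic ψ ↔ @Joined _ pointTopology φ ψ := by
  let _ : TopologicalSpace (Extension D B) := pointTopology
  have hcont : ∀ h : unitInterval → Extension D B,
      Continuous h ↔ ∀ a, Continuous fun t => h t a := fun h => by
    rw [continuous_induced_rng, continuous_pi_iff]
    rfl
  constructor
  · rintro ⟨h, hc, h0, h1⟩
    exact ⟨⟨⟨h, (hcont h).2 hc⟩, h0, h1⟩⟩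
  · rintro ⟨γ⟩
    exact ⟨γ, (hcont γ).1 γ.continuous, γ.source, γ.target⟩

theorem Extension.StronglyHomotopic.trans {φ ψ χ : Extension D B} (h₁ : φ.StronglyHomotopic ψ)
    (h₂ : ψ.StronglyHomotopic χ) : φ.StronglyHomotopic χ := by
  let _ : TopologicalSpace (Extension D B) := pointTopology
  rw [stronglyHomotopic_iff_joined] at *
  exact Joined.trans h₁ h₂

theorem Extension.StronglyHomotopic.symm {φ ψ : Extension D B} (h : φ.StronglyHomotopic ψ) :
    ψ.StronglyHomotopic φ := by
  let _ : TopologicalSpace (Extension D B) := pointTopology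
  rw [stronglyHomotopic_iff_joined] at *
  exact Joined.symm h

theorem Extension.StronglyHomotopic.sum_right (P : IsometryPair B) {φ φ' : Extension D B}
    (h : φ.StronglyHomotopic φ') (ψ : Extension D B) :
    (φ.sum P ψ).StronglyHomotopic (φ'.sum P ψ) := by
  obtain ⟨H, hc, rfl, rfl⟩ := h
  refine ⟨fun t => (H t).sum P ψ, fun a => ?_, rfl, rfl⟩
  change Continuous fun t => q B P.V₁ * H t a * star (q B P.V₁) +
    q B P.V₂ * ψ a * star (q B P.V₂)
  have := hc a
  fun_prop

theorem Extension.StronglyHomotopic.comp {φ φ' : Extension D B} (h : φ.StronglyHomotopic φ')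
    (f : E →⋆ₙₐ[ℂ] D) :
    Extension.StronglyHomotopic (NonUnitalStarAlgHom.comp φ f)
      (NonUnitalStarAlgHom.comp φ' f) := by
  obtain ⟨H, hc, rfl, rfl⟩ := h
  exact ⟨fun t => NonUnitalStarAlgHom.comp (H t) f, fun a => hc (f a), rfl, rfl⟩

theorem Extension.IsSplit.comp {φ : Extension D B} (h : φ.IsSplit) (f : E →⋆ₙₐ[ℂ] D) :
    Extension.IsSplit (NonUnitalStarAlgHom.comp φ f) := by
  obtain ⟨π, hπ⟩ := h
  exact ⟨π.comp f, fun a => hπ (f a)⟩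

theorem Extension.IsAsymptoticallySplit.comp {φ : Extension D B} (h : φ.IsAsymptoticallySplit)
    (f : E →⋆ₙₐ[ℂ] D) : Extension.IsAsymptoticallySplit (NonUnitalStarAlgHom.comp φ f) := by
  obtain ⟨π, hπ, hq⟩ := h
  refine ⟨fun t a => π t (f a), ⟨fun a => hπ.continuousOn _, fun a b c => ?_, fun a b => ?_,
    fun a => ?_⟩, fun t ht a => hq t ht (f a)⟩
  · simpa only [map_add, map_smul] using hπ.add_smul (f a) (f b) c
  · simpa only [map_mul] using hπ.mul (f a) (f b)
  · simpa only [map_star] using hπ.star (f a)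

end StrongHomotopy

/-! ### Re-bracketing sums, and extensions from two-by-two matrices. -/

section IsometryPairs

variable {D E B : Type*} [NonUnitalCStarAlgebra D] [NonUnitalCStarAlgebra E]
  [NonUnitalCStarAlgebra B]

/-- The isometry pair `(V'₁ V₁, V'₁ V₂ V₁* + V'₂ V₂*)`, for re-bracketing sums of extensions. -/
def IsometryPair.reassoc (P P' : IsometryPair B) : IsometryPair B where
  V₁ := P'.V₁ * P.V₁
  V₂ := P'.V₁ * P.V₂ * star P.V₁ + P'.V₂ * star P.V₂
  isometry₁ := by
    have : star (P'.V₁ * P.V₁) * (P'.V₁ * P.V₁) =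
        star P.V₁ * (star P'.V₁ * P'.V₁) * P.V₁ := by rw [star_mul]; simp only [mul_assoc]
    rw [this, P'.isometry₁, mul_one, P.isometry₁]
  isometry₂ := by
    have h1 : ∀ x, star P'.V₁ * (P'.V₁ * x) = x := fun x => by
      rw [← mul_assoc, P'.isometry₁, one_mul]
    have h2 : ∀ x, star P'.V₂ * (P'.V₂ * x) = x := fun x => by
      rw [← mul_assoc, P'.isometry₂, one_mul]
    have h3 : ∀ x, star P'.V₁ * (P'.V₂ * x) = 0 := fun x => by
      rw [← mul_assoc, P'.orthogonal, zero_mul]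
    have h4 : ∀ x, star P'.V₂ * (P'.V₁ * x) = 0 := fun x => by
      rw [← mul_assoc, P'.orthogonal', zero_mul]
    have h5 : ∀ x, star P.V₂ * (P.V₂ * x) = x := fun x => by
      rw [← mul_assoc, P.isometry₂, one_mul]
    simp only [star_add, star_mul, star_star, add_mul, mul_add, mul_assoc, h1, h2, h3, h4, h5,
      mul_zero, add_zero, zero_add, P.sum_range]
  sum_range := by
    have h1 : ∀ x, star P.V₁ * (P.V₁ * x) = x := fun x => by
      rw [← mul_assoc, P.isometry₁, one_mul]
    have h2 : ∀ x, star P.V₂ * (P.V₂ * x) = x := fun x => by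
      rw [← mul_assoc, P.isometry₂, one_mul]
    have h3 : ∀ x, star P.V₁ * (P.V₂ * x) = 0 := fun x => by
      rw [← mul_assoc, P.orthogonal, zero_mul]
    have h4 : ∀ x, star P.V₂ * (P.V₁ * x) = 0 := fun x => by
      rw [← mul_assoc, P.orthogonal', zero_mul]
    simp only [star_add, star_mul, star_star, add_mul, mul_add, mul_assoc, h1, h2, h3, h4,
      mul_zero, add_zero, zero_add]
    have e : P'.V₁ * (P.V₁ * (star P.V₁ * star P'.V₁)) +
        (P'.V₁ * (P.V₂ * (star P.V₂ * star P'.V₁)) + P'.V₂ * star P'.V₂) =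
        P'.V₁ * (P.V₁ * star P.V₁ + P.V₂ * star P.V₂) * star P'.V₁ + P'.V₂ * star P'.V₂ := by
      noncomm_ring
    rw [e, P.sum_range, mul_one, P'.sum_range]

variable (P : IsometryPair B)

theorem IsometryPair.q_star_mul_cancel₁ (x : Corona B) :
    star (q B P.V₁) * (q B P.V₁ * x) = x := by
  rw [← mul_assoc, ← q_star, ← map_mul, P.isometry₁, map_one, one_mul]

theorem IsometryPair.q_star_mul_cancel₂ (x : Corona B) :
    star (q B P.V₂) * (q B P.V₂ * x) = x := by
  rw [← mul_assoc, ← q_star, ← map_mul, P.isometry₂, map_one, one_mul]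

theorem IsometryPair.q_star_mul_zero (x : Corona B) : star (q B P.V₁) * (q B P.V₂ * x) = 0 := by
  rw [← mul_assoc, ← q_star, ← map_mul, P.orthogonal, map_zero, zero_mul]

theorem IsometryPair.q_star_mul_zero' (x : Corona B) : star (q B P.V₂) * (q B P.V₁ * x) = 0 := by
  rw [← mul_assoc, ← q_star, ← map_mul, P.orthogonal', map_zero, zero_mul]

theorem Extension.sum_apply (φ ψ : Extension D B) (a : D) : φ.sum P ψ a =
    q B P.V₁ * φ a * star (q B P.V₁) + q B P.V₂ * ψ a * star (q B P.V₂) := rfl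

/-- The second isometry `W` of the new pair satisfies `W V₁ = V'₁ V₂` and `W V₂ = V'₂`. The equality
is exact, so no unitary equivalence of sums has to be invoked. -/
theorem Extension.sum_reassoc (P' : IsometryPair B) (φ ψ χ : Extension D B) :
    φ.sum (P.reassoc P') (ψ.sum P χ) = (φ.sum P ψ).sum P' χ := by
  refine NonUnitalStarAlgHom.ext fun a => ?_
  simp only [Extension.sum_apply, IsometryPair.reassoc, map_add, map_mul, star_add, star_mul,
    q_star, star_star, mul_add, add_mul, mul_assoc, P.q_star_mul_cancel₁, P.q_star_mul_cancel₂,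
    P.q_star_mul_zero, P.q_star_mul_zero', mul_zero, add_zero, zero_add]
  abel

theorem Extension.sum_comp (φ ψ : Extension D B) (f : E →⋆ₙₐ[ℂ] D) :
    NonUnitalStarAlgHom.comp (φ.sum P ψ) f =
      Extension.sum P (NonUnitalStarAlgHom.comp φ f) (NonUnitalStarAlgHom.comp ψ f) := rfl

/-- The extension `a ↦ ∑ q(Vᵢ) φ(eᵢⱼ(a)) q(Vⱼ)*` given by a ⋆-homomorphism `(eᵢⱼ)` into
two-by-two matrices. -/
def Extension.ofMatrix (φ : Extension D B) (e₁₁ e₁₂ e₂₁ e₂₂ : E →ₗ[ℂ] D)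
    (h₁₁ : ∀ a b, e₁₁ (a * b) = e₁₁ a * e₁₁ b + e₁₂ a * e₂₁ b)
    (h₁₂ : ∀ a b, e₁₂ (a * b) = e₁₁ a * e₁₂ b + e₁₂ a * e₂₂ b)
    (h₂₁ : ∀ a b, e₂₁ (a * b) = e₂₁ a * e₁₁ b + e₂₂ a * e₂₁ b)
    (h₂₂ : ∀ a b, e₂₂ (a * b) = e₂₁ a * e₁₂ b + e₂₂ a * e₂₂ b)
    (s₁₁ : ∀ a, e₁₁ (star a) = star (e₁₁ a)) (s₁₂ : ∀ a, e₁₂ (star a) = star (e₂₁ a))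
    (s₂₁ : ∀ a, e₂₁ (star a) = star (e₁₂ a)) (s₂₂ : ∀ a, e₂₂ (star a) = star (e₂₂ a)) :
    Extension E B where
  toFun a := q B P.V₁ * φ (e₁₁ a) * star (q B P.V₁) + q B P.V₁ * φ (e₁₂ a) * star (q B P.V₂) +
    q B P.V₂ * φ (e₂₁ a) * star (q B P.V₁) + q B P.V₂ * φ (e₂₂ a) * star (q B P.V₂)
  map_smul' c a := by simp [smul_add]
  map_zero' := by simp
  map_add' a b := by
    simp only [map_add, mul_add, add_mul]
    abel
  map_mul' a b := by
    simp only [h₁₁, h₁₂, h₂₁, h₂₂, map_add, map_mul, mul_add, add_mul, mul_assoc,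
      P.q_star_mul_cancel₁, P.q_star_mul_cancel₂, P.q_star_mul_zero, P.q_star_mul_zero', mul_zero,
      add_zero, zero_add]
    abel
  map_star' a := by
    simp only [s₁₁, s₁₂, s₂₁, s₂₂, map_star, star_add, star_mul, star_star, mul_assoc]
    abel

end IsometryPairs

/-! ### Folding and contracting the circle. -/

section CircleMaps

/-- The contraction `s ↦ (x + iy ↦ exp (i s arccos x))` of the folded circle. -/
def circleFold (s : ℝ) : C(Circle, Circle) where
  toFun z := Circle.exp (s * Real.arccos (z : ℂ).re)
  continuous_toFun := by
    have : Continuous fun z : Circle => (z : ℂ).re := by fun_prop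
    exact Circle.exp.continuous.comp (continuous_const.mul (Real.continuous_arccos.comp this))

/-- Complex conjugation on the circle. -/
def circleInv : C(Circle, Circle) := ⟨fun z => z⁻¹, continuous_inv⟩

theorem circleFold_zero (z : Circle) : circleFold 0 z = 1 := by
  simp [circleFold]

theorem coe_circleFold_one (z : Circle) :
    (circleFold 1 z : ℂ) = ⟨(z : ℂ).re, |(z : ℂ).im|⟩ := by
  have hn : (z : ℂ).re * (z : ℂ).re + (z : ℂ).im * (z : ℂ).im = 1 := by
    rw [← Complex.normSq_apply, Circle.normSq_coe]
  have hre : |(z : ℂ).re| ≤ 1 := (Complex.abs_re_le_norm _).trans (Circle.norm_coe z).le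
  obtain ⟨h1, h2⟩ := abs_le.1 hre
  change ((Circle.exp (1 * Real.arccos (z : ℂ).re) : Circle) : ℂ) = _
  rw [one_mul, Circle.coe_exp]
  apply Complex.ext
  · rw [Complex.exp_ofReal_mul_I_re, Real.cos_arccos h1 h2]
  · rw [Complex.exp_ofReal_mul_I_im, Real.sin_arccos, ← Real.sqrt_sq_eq_abs]
    congr 1
    nlinarith

theorem circleFold_one_of_nonneg {z : Circle} (h : 0 ≤ (z : ℂ).im) : circleFold 1 z = z := by
  refine Circle.ext ?_
  rw [coe_circleFold_one, abs_of_nonneg h]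

theorem circleFold_one_of_nonpos {z : Circle} (h : (z : ℂ).im ≤ 0) : circleFold 1 z = z⁻¹ := by
  refine Circle.ext ?_
  rw [coe_circleFold_one, abs_of_nonpos h, Circle.coe_inv_eq_conj]
  rfl

end CircleMaps

/-! ### Rotation on the lower half circle and contraction to a point. -/

section Circle

variable {A B : Type*} [NonUnitalCStarAlgebra A] [NonUnitalCStarAlgebra B]

/-- Composition with a continuous map, as a ⋆-homomorphism. -/
def precomp (f : C(Circle, Circle)) : C(Circle, A) →⋆ₙₐ[ℂ] C(Circle, A) where
  toFun g := g.comp f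
  map_smul' _ _ := rfl
  map_zero' := rfl
  map_add' _ _ := rfl
  map_mul' _ _ := rfl
  map_star' _ := rfl

/-- Constant functions. -/
def constHom : A →⋆ₙₐ[ℂ] C(Circle, A) where
  toFun a := ContinuousMap.const _ a
  map_smul' _ _ := rfl
  map_zero' := rfl
  map_add' _ _ := rfl
  map_mul' _ _ := rfl
  map_star' _ := rfl

/-- Evaluation at the base point of the circle. -/
def evalOne : C(Circle, A) →⋆ₙₐ[ℂ] A where
  toFun g := g 1
  map_smul' _ _ := rfl
  map_zero' := rfl
  map_add' _ _ := rfl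
  map_mul' _ _ := rfl
  map_star' _ := rfl

/-- The part of a function on the lower half circle that is odd under conjugation, up to sign. -/
def lowerPart : C(Circle, A) →ₗ[ℂ] C(Circle, A) where
  toFun g := g - precomp (circleFold 1) g
  map_add' g g' := by rw [map_add]; abel
  map_smul' c g := by simp [smul_sub]

theorem lowerPart_apply_of_nonneg (g : C(Circle, A)) {z : Circle} (h : 0 ≤ (z : ℂ).im) :
    lowerPart g z = 0 := by
  change g z - g (circleFold 1 z) = 0
  rw [circleFold_one_of_nonneg h, sub_self]

theorem lowerPart_apply_of_nonpos (g : C(Circle, A)) {z : Circle} (h : (z : ℂ).im ≤ 0) :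
    lowerPart g z = g z - precomp circleInv g z := by
  change g z - g (circleFold 1 z) = g z - g (z⁻¹)
  rw [circleFold_one_of_nonpos h]

theorem lowerPart_star (g : C(Circle, A)) : lowerPart (star g) = star (lowerPart g) := by
  change star g - precomp _ (star g) = star (g - precomp _ g)
  rw [map_star, star_sub]

theorem lowerPart_mul (g g' : C(Circle, A)) :
    lowerPart (g * g') = lowerPart g * g' + g * lowerPart g' - lowerPart g * lowerPart g' := by
  change g * g' - precomp _ (g * g') = (g - precomp _ g) * g' + g * (g' - precomp _ g') -
    (g - precomp _ g) * (g' - precomp _ g')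
  rw [map_mul]
  noncomm_ring

/-- On the upper half circle both sides vanish. On the lower half, conjugating `g'` amounts to
subtracting its lower part. -/
theorem lowerPart_mul_precomp_circleInv (g g' : C(Circle, A)) :
    lowerPart g * precomp circleInv g' = lowerPart g * g' - lowerPart g * lowerPart g' := by
  ext z
  simp only [ContinuousMap.mul_apply, ContinuousMap.sub_apply]
  rcases le_total 0 (z : ℂ).im with h | h
  · simp [lowerPart_apply_of_nonneg _ h]
  · rw [lowerPart_apply_of_nonpos g' h]
    noncomm_ring

theorem precomp_circleInv_mul_lowerPart (g g' : C(Circle, A)) :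
    precomp circleInv g * lowerPart g' = g * lowerPart g' - lowerPart g * lowerPart g' := by
  ext z
  simp only [ContinuousMap.mul_apply, ContinuousMap.sub_apply]
  rcases le_total 0 (z : ℂ).im with h | h
  · simp [lowerPart_apply_of_nonneg _ h]
  · rw [lowerPart_apply_of_nonpos g h]
    noncomm_ring

/-- The rotation of `diag (g, g ∘ conj)` by an angle on the lower half circle. -/
theorem exists_rotation (P : IsometryPair B) (φ : Extension C(Circle, A) B) (t : unitInterval) :
    ∃ ψ : Extension C(Circle, A) B, ∀ g, ψ g =
      q B P.V₁ * (φ g - ((t : ℝ) : ℂ) • φ (lowerPart g)) * star (q B P.V₁) +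
      q B P.V₁ * ((√(t * (1 - t)) : ℝ) : ℂ) • φ (lowerPart g) * star (q B P.V₂) +
      q B P.V₂ * ((√(t * (1 - t)) : ℝ) : ℂ) • φ (lowerPart g) * star (q B P.V₁) +
      q B P.V₂ * (φ (precomp circleInv g) + ((t : ℝ) : ℂ) • φ (lowerPart g)) *
        star (q B P.V₂) := by
  set c : ℂ := ((t : ℝ) : ℂ) with hc
  set β : ℂ := ((√(t * (1 - t)) : ℝ) : ℂ) with hβ
  -- With `cos² = 1 - t` and `sin² = t`, the rotated diagonal entries are `(1 - t) g + t (g ∘ conj)`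
  -- and its mirror image, and the off-diagonal ones `cos · sin · (g - g ∘ conj)`. On the upper half
  -- circle the lower part vanishes and the matrix stays diagonal.
  have hββ : β * β = c * (1 - c) := by
    rw [hβ, hc, ← Complex.ofReal_mul, Real.mul_self_sqrt]
    · push_cast; ring
    · exact mul_nonneg t.2.1 (sub_nonneg.2 t.2.2)
  have hcs : star c = c := by rw [hc]; exact Complex.conj_ofReal _
  have hβs : star β = β := by rw [hβ]; exact Complex.conj_ofReal _
  let I : C(Circle, A) →ₗ[ℂ] C(Circle, A) :=
    { toFun := precomp circleInv
      map_add' := map_add _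
      map_smul' := map_smul _ }
  have hI : ∀ g, I g = precomp circleInv g := fun _ => rfl
  refine ⟨Extension.ofMatrix P φ (LinearMap.id - c • lowerPart) (β • lowerPart) (β • lowerPart)
    (I + c • lowerPart) ?_ ?_ ?_ ?_ ?_ ?_ ?_ ?_, fun g => ?_⟩
  · intro g g'
    simp only [LinearMap.sub_apply, LinearMap.smul_apply, LinearMap.id_apply, lowerPart_mul,
      mul_sub, sub_mul, smul_mul_assoc, mul_smul_comm]
    match_scalars <;> first | ring1 | linear_combination hββ | linear_combination -hββ
  · intro g g'
    simp only [LinearMap.sub_apply, LinearMap.add_apply, LinearMap.smul_apply, LinearMap.id_apply,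
      lowerPart_mul, hI, mul_add, sub_mul, smul_mul_assoc, mul_smul_comm,
      lowerPart_mul_precomp_circleInv]
    module
  · intro g g'
    simp only [LinearMap.sub_apply, LinearMap.add_apply, LinearMap.smul_apply, LinearMap.id_apply,
      lowerPart_mul, hI, add_mul, mul_sub, smul_mul_assoc, mul_smul_comm,
      precomp_circleInv_mul_lowerPart]
    module
  · intro g g'
    simp only [LinearMap.add_apply, LinearMap.smul_apply, lowerPart_mul, hI, map_mul,
      mul_add, add_mul, smul_mul_assoc, mul_smul_comm,
      precomp_circleInv_mul_lowerPart, lowerPart_mul_precomp_circleInv]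
    match_scalars <;> first | ring1 | linear_combination hββ | linear_combination -hββ
  · intro g
    simp only [LinearMap.sub_apply, LinearMap.smul_apply, LinearMap.id_apply, lowerPart_star,
      star_sub, star_smul, hcs]
  · intro g
    simp only [LinearMap.smul_apply, lowerPart_star, star_smul, hβs]
  · intro g
    simp only [LinearMap.smul_apply, lowerPart_star, star_smul, hβs]
  · intro g
    simp only [LinearMap.add_apply, LinearMap.smul_apply, lowerPart_star, star_add, star_smul, hcs,
      hI, map_star]
  · change q B P.V₁ * φ ((LinearMap.id - c • lowerPart : C(Circle, A) →ₗ[ℂ] C(Circle, A)) g) *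
        star (q B P.V₁) +
      q B P.V₁ * φ ((β • lowerPart : C(Circle, A) →ₗ[ℂ] C(Circle, A)) g) * star (q B P.V₂) +
      q B P.V₂ * φ ((β • lowerPart : C(Circle, A) →ₗ[ℂ] C(Circle, A)) g) * star (q B P.V₁) +
      q B P.V₂ * φ ((I + c • lowerPart : C(Circle, A) →ₗ[ℂ] C(Circle, A)) g) * star (q B P.V₂) = _
    simp only [LinearMap.sub_apply, LinearMap.add_apply, LinearMap.smul_apply, LinearMap.id_apply,
      hI, map_sub, map_add, map_smul]

/-- At `t = 1` the rotation has exchanged the two summands over the lower half circle, so the first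
is everywhere `g` on the folded point and the second `g` on its conjugate. -/
theorem stronglyHomotopic_fold (P : IsometryPair B) (φ : Extension C(Circle, A) B) :
    Extension.StronglyHomotopic
      (Extension.sum P φ (NonUnitalStarAlgHom.comp φ (precomp circleInv)))
      (Extension.sum P (NonUnitalStarAlgHom.comp φ (precomp (circleFold 1)))
        (NonUnitalStarAlgHom.comp φ (precomp (circleInv.comp (circleFold 1))))) := by
  choose ψ hψ using exists_rotation P φ
  refine ⟨ψ, fun g => ?_, NonUnitalStarAlgHom.ext fun g => ?_, NonUnitalStarAlgHom.ext fun g => ?_⟩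
  · simp only [hψ]
    have h1 : Continuous fun t : unitInterval => ((t : ℝ) : ℂ) := by fun_prop
    have h2 : Continuous fun t : unitInterval => ((√(t * (1 - t)) : ℝ) : ℂ) := by fun_prop
    fun_prop
  · rw [hψ, Extension.sum_apply]
    simp
  · rw [hψ, Extension.sum_apply]
    have e1 : g - lowerPart g = precomp (circleFold 1) g := sub_sub_cancel _ _
    have e2 : precomp circleInv g + lowerPart g =
        precomp (circleInv.comp (circleFold 1)) g := by
      ext z
      change g z⁻¹ + lowerPart g z = g (circleFold 1 z)⁻¹
      rcases le_total 0 (z : ℂ).im with h | h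
      · rw [lowerPart_apply_of_nonneg _ h, circleFold_one_of_nonneg h, add_zero]
      · rw [lowerPart_apply_of_nonpos _ h, circleFold_one_of_nonpos h, inv_inv]
        exact add_sub_cancel _ _
    simp only [Set.Icc.coe_one, Complex.ofReal_one, one_smul, sub_self, mul_zero, Real.sqrt_zero,
      Complex.ofReal_zero, zero_smul, zero_mul, add_zero]
    rw [← map_sub, ← map_add, e1, e2]
    rfl

theorem continuous_circleFold : Continuous fun s : unitInterval => circleFold (s : ℝ) := by
  refine ContinuousMap.continuous_of_continuous_uncurry _ ?_
  change Continuous fun p : unitInterval × Circle =>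
    Circle.exp ((p.1 : ℝ) * Real.arccos ((p.2 : Circle) : ℂ).re)
  fun_prop

/-- The folded circle is an arc, which `circleFold s` shrinks to the base point as `s` decreases to
`0`. -/
theorem stronglyHomotopic_contract (P : IsometryPair B) (φ : Extension C(Circle, A) B) :
    Extension.StronglyHomotopic
      (Extension.sum P (NonUnitalStarAlgHom.comp φ (precomp (circleFold 1)))
        (NonUnitalStarAlgHom.comp φ (precomp (circleInv.comp (circleFold 1)))))
      (NonUnitalStarAlgHom.comp (Extension.sum P (NonUnitalStarAlgHom.comp φ constHom)
        (NonUnitalStarAlgHom.comp φ constHom)) evalOne) := by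
  refine Extension.StronglyHomotopic.symm
    ⟨fun s => Extension.sum P (NonUnitalStarAlgHom.comp φ (precomp (circleFold s)))
        (NonUnitalStarAlgHom.comp φ (precomp (circleInv.comp (circleFold s)))),
      fun g => ?_, NonUnitalStarAlgHom.ext fun g => ?_, ?_⟩
  · have h1 : Continuous fun s : unitInterval => φ (g.comp (circleFold s)) :=
      φ.continuous.comp ((ContinuousMap.continuous_postcomp g).comp continuous_circleFold)
    have h2 : Continuous fun s : unitInterval => φ (g.comp (circleInv.comp (circleFold s))) :=
      φ.continuous.comp ((ContinuousMap.continuous_postcomp g).comp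
        ((ContinuousMap.continuous_postcomp circleInv).comp continuous_circleFold))
    change Continuous fun s : unitInterval =>
      q B P.V₁ * φ (g.comp (circleFold s)) * star (q B P.V₁) +
      q B P.V₂ * φ (g.comp (circleInv.comp (circleFold s))) * star (q B P.V₂)
    exact ((continuous_const.mul h1).mul continuous_const).add
      ((continuous_const.mul h2).mul continuous_const)
  · have e1 : precomp (circleFold ((0 : unitInterval) : ℝ)) g = constHom (evalOne g) := by
      ext z
      change g (circleFold 0 z) = g 1
      rw [circleFold_zero]
    have e2 : precomp (circleInv.comp (circleFold ((0 : unitInterval) : ℝ))) g =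
        constHom (evalOne g) := by
      ext z
      change g (circleFold 0 z)⁻¹ = g 1
      rw [circleFold_zero, inv_one]
    simp only [NonUnitalStarAlgHom.comp_apply, Extension.sum_apply, e1, e2]
  · rfl

/-- Every extension of `C(𝕋) ⊗ A` becomes strongly homotopic, after adding its conjugate, to a
pullback from `A` along the evaluation at the base point. -/
theorem Extension.stronglyHomotopic_evalOne (P P' : IsometryPair B)
    (φ : Extension C(Circle, A) B) (χ : Extension A B) :
    Extension.StronglyHomotopic
      (Extension.sum (P.reassoc P') φ (Extension.sum P
        (NonUnitalStarAlgHom.comp φ (precomp circleInv)) (NonUnitalStarAlgHom.comp χ evalOne)))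
      (NonUnitalStarAlgHom.comp (Extension.sum P'
        (Extension.sum P (NonUnitalStarAlgHom.comp φ constHom)
          (NonUnitalStarAlgHom.comp φ constHom)) χ) evalOne) := by
  rw [Extension.sum_reassoc, Extension.sum_comp]
  exact Extension.StronglyHomotopic.sum_right P'
    ((stronglyHomotopic_fold P φ).trans (stronglyHomotopic_contract P φ)) _

end Circle

end

end CStarExt

theorem lemma4p7 {A : Type*} [NonUnitalCStarAlgebra A] [TopologicalSpace.SeparableSpace A]
    {B : Type*} [NonUnitalCStarAlgebra B] [TopologicalSpace.SeparableSpace B]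
    (hB : CStarExt.IsStable B) :
    ((∀ φ : CStarExt.Extension A B, φ.IsSemiInvertible) →
      ∀ φ : CStarExt.Extension C(Circle, A) B, φ.IsSemiInvertible) ∧
    ((∀ φ : CStarExt.Extension A B, φ.IsStronglyHomotopyInvertible) →
      ∀ φ : CStarExt.Extension C(Circle, A) B, φ.IsStronglyHomotopyInvertible) := by
  refine ⟨fun h φ => ?_, fun h φ => ?_⟩
  · obtain ⟨P, -⟩ := h 0
    obtain ⟨P', χ, hχ⟩ := h (CStarExt.Extension.sum P
      (NonUnitalStarAlgHom.comp φ CStarExt.constHom) (NonUnitalStarAlgHom.comp φ CStarExt.constHom))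
    -- This makes `C(Circle, A)` separable, as homotopy invariance of asymptotic splitting requires.
    have _ := UniformSpace.secondCountable_of_separable A
    exact ⟨P.reassoc P', _, (CStarExt.Extension.stronglyHomotopic_evalOne P P' φ
      χ).symm.isAsymptoticallySplit (hχ.comp CStarExt.evalOne)⟩
  · obtain ⟨P, -⟩ := h 0
    obtain ⟨P', χ, σ, hσ, hχ⟩ := h (CStarExt.Extension.sum P
      (NonUnitalStarAlgHom.comp φ CStarExt.constHom) (NonUnitalStarAlgHom.comp φ CStarExt.constHom))
    exact ⟨P.reassoc P', _, _, hσ.comp CStarExt.evalOne,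
      (CStarExt.Extension.stronglyHomotopic_evalOne P P' φ χ).trans (hχ.comp CStarExt.evalOne)⟩
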